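/- Let $N\ge 5$, let $d$ be an even positive integer with $d\le N-2$, and let $K,n$ be non-negative integers. For a permutation $\pi=(\pi_1,\dots,\pi_N)$ of $\{1,\dots,N\}$, with indices read cyclically ($\pi_{N+j}:=\pi_j$), let $E=E(\pi)$ be the symmetric set of all pairs $(\pi_i,\pi_{i+j})$ and $(\pi_{i+j},\pi_i)$ with $1\le i\le N$, $1\le j\le d/2$; let $H\in\{0,1\}^{N\times N}$ be its matrix ($H_{ab}=1$ iff $(a,b)\in E$), and let $S:=E\cup\{(a,a):1\le a\le N\}$. Call a probability law on $\mathbb{R}^N$ multivariate sub-Gaussian with precision matrix $\Omega\succ0$ and parameter $\sigma$ if it has mean $0$ and covariance $\Sigma=\Omega^{-1}$, and if each $X_i/\sqrt{\Sigma_{ii}}$ satisfies $\mathbb{E}\,e^{\lambda X_i/\sqrt{\Sigma_{ii}}}\le e^{\sigma^2\lambda^2/2}$ for all $\lambda\in\mathbb{R}$. **Experiment.** Let $\pi$ be a uniformly random permutation. Let $Q^{(1)},\dots,Q^{(K)}$ be (random or deterministic) matrices, jointly independent of $\pi$, that are almost surely symmetric with entries in $[-1/(2d),1/(2d)]$. Conditionally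 on $\pi$ and $\mathbf Q=(Q^{(k)})_k$, let $\mathbf X=\{X^{(k)}_t\}_{1\le t\le n,\,1\le k\le K}$ be independent with $X^{(k)}_t\sim\mathcal N(0,\bar\Sigma^{(k)})$, where $\bar\Sigma^{(k)}=(I+H\odot Q^{(k)})^{-1}$ and $\odot$ is the entrywise product. 1. For every $\pi$, each $a$ has exactly $d$ neighbours in $E$. For every symmetric $Q$ with entries in $[-1/(2d),1/(2d)]$, the matrix $I+H\odot Q$ is positive definite, its support is contained in $S$, and $\mathcal N(0,(I+H\odot Q)^{-1})$ is multivariate sub-Gaussian with precision matrix $I+H\odot Q$ and every parameter $\sigma\ge1$. Moreover, let $Q_0$ be symmetric with entries in $[-1/(2d),1/(2d)]$ and non-zero off-diagonal entries, and fix a value of $\pi$. Put $\bar\Omega=I+H\odot Q_0$ and $\Delta^{(k)}=H\odot(Q^{(k)}-Q_0)$. If the $Q^{(k)}$ are i.i.d. and, for some $0<c\le\lambda_{\min}(\bar\Omega)/2$, almost surely $\|\Delta^{(k)}\|_2\le c$ (spectral norm) for all $k$, then $\operatorname{supp}\bar\Omega=S$ and, conditionally on $\pi$, for every $\sigma\ge1$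 the samples $\mathbf X$ follow a family of random multivariate sub-Gaussian distributions of size $K$ with parameter $\sigma$ and true common precision matrix $\bar\Omega$. That is: $\bar\Omega\succ0$; the $\Delta^{(k)}$ are i.i.d.; there are $\gamma>0$ and $c_{\max}\in(0,\lambda_{\min}(\bar\Omega)/2]$ such that almost surely, for all $k$, $\bar\Omega+\Delta^{(k)}\succ0$, $\operatorname{supp}\Delta^{(k)}\subseteq\operatorname{supp}\bar\Omega$, all entries of $(\bar\Omega+\Delta^{(k)})^{-1}$ are at most $\gamma$ in absolute value and $\|\Delta^{(k)}\|_2\le c_{\max}$; the entries of $(\bar\Omega+\Delta^{(k)})^{-1}$ are integrable; and, given the $\bar\Omega+\Delta^{(k)}$, the samples are independent, those of task $k$ being identically distributed and multivariate sub-Gaussian with precision matrix $\bar\Omega+\Delta^{(k)}$ and parameter $\sigma$. 2. In every such experiment, for every estimate $\hat S$ of $S$ (a measurable function of $\mathbf X$, possibly also of $\mathbf Q$ and of external randomness independent of $(\pi,\mathbf Q,\mathbf X)$), $$\mathbb{P}\{\hat S\neq S\}\ \ge\ 1-\frac{nNK+\log 2}{N\log N-N-\log(2N)} .$$ 3. If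 moreover $K\ge1$ and $n\le\frac{\log N}{2K}-\frac1{2K}-\frac{\log(8N)}{2NK}$, then $\mathbb{P}\{\hat S\ne S\}>1/2$ for every such $\hat S$. Hence $\Omega((\log N)/K)$ samples per task are necessary: there are absolute constants $c>0$ and $N_0$ such that, for all $N\ge\max(N_0,5)$, all even $d$ with $0<d\le N-2$, all $K\ge1$ and all $n$, in every such experiment any estimate $\hat S$ with $\mathbb{P}\{\hat S\neq S\}\le1/2$ requires $n\ge c\,(\log N)/K$. -/

import Mathlib

open MeasureTheory ProbabilityTheory
open scoped Matrix ENNReal NNReal Nat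

noncomputable section

namespace SupportUnion

/-- Real `N × N` arrays, with the product σ-algebra. -/
abbrev Coupling (N : ℕ) := Fin N → Fin N → ℝ

/-- `n` observations in `ℝ^N` for each of `K` tasks. -/
abbrev Data (N K n : ℕ) := Fin K → Fin n → EuclideanSpace ℝ (Fin N)

/-- Permutations of a finite set carry the discrete σ-algebra. -/
instance permMeasurableSpace (N : ℕ) : MeasurableSpace (Equiv.Perm (Fin N)) := ⊤

/-- The support of a matrix. -/
def matSupport {N : ℕ} (A : Matrix (Fin N) (Fin N) ℝ) : Set (Fin N × Fin N) :=
  {p | A p.1 p.2 ≠ 0}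

/-- The position `j` steps after `i` on the cycle `0, 1, …, N - 1, 0, …`. -/
def cyclicShift {N : ℕ} (i : Fin N) (j : ℕ) : Fin N :=
  ⟨(i.val + j) % N, Nat.mod_lt _ i.pos⟩

/-- The edge set produced by the permutation `π`: the pairs `(π i, π (i + j))`, `1 ≤ j ≤ d / 2`,
indices taken cyclically. The graph is undirected, so both orientations are recorded. -/
def edgeSet {N : ℕ} (d : ℕ) (π : Equiv.Perm (Fin N)) : Set (Fin N × Fin N) :=
  {p | ∃ i : Fin N, ∃ j : ℕ, 1 ≤ j ∧ j ≤ d / 2 ∧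
    (p = (π i, π (cyclicShift i j)) ∨ p = (π (cyclicShift i j), π i))}

/-- The support union: the edges together with the diagonal. -/
def supportUnion {N : ℕ} (d : ℕ) (π : Equiv.Perm (Fin N)) : Set (Fin N × Fin N) :=
  edgeSet d π ∪ {p | p.1 = p.2}

/-- The `0`-`1` matrix `H` of the edge set. -/
def edgeMatrix {N : ℕ} (d : ℕ) (π : Equiv.Perm (Fin N)) : Matrix (Fin N) (Fin N) ℝ :=
  Matrix.of fun a b => (edgeSet d π).indicator (fun _ => (1 : ℝ)) (a, b)

/-- The precision matrix `I + H ⊙ Q`. -/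
def precision {N : ℕ} (d : ℕ) (π : Equiv.Perm (Fin N)) (q : Coupling N) :
    Matrix (Fin N) (Fin N) ℝ :=
  1 + edgeMatrix d π ⊙ Matrix.of q

/-- Symmetric matrices with entries in `[-1/(2d), 1/(2d)]`. -/
def couplingBox (N d : ℕ) : Set (Coupling N) :=
  {q | (∀ a b, q a b = q b a) ∧
    ∀ a b, q a b ∈ Set.Icc (-(1 / (2 * (d : ℝ)))) (1 / (2 * (d : ℝ)))}

/-- The law `μ` on `ℝ^N` is a multivariate sub-Gaussian distribution with precision matrix `A`
and parameter `σ`: it is centred with covariance `A⁻¹`, and each coordinate divided by its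
standard deviation is sub-Gaussian with parameter `σ`. -/
structure IsSubGaussianVector {N : ℕ} (μ : Measure (EuclideanSpace ℝ (Fin N)))
    (A : Matrix (Fin N) (Fin N) ℝ) (σ : ℝ≥0) : Prop where
  isProbabilityMeasure : IsProbabilityMeasure μ
  posDef : A.PosDef
  memLp : ∀ i, MemLp (fun x : EuclideanSpace ℝ (Fin N) => x i) 2 μ
  mean : ∀ i, ∫ x, x i ∂μ = 0
  covariance : ∀ i j, cov[fun x : EuclideanSpace ℝ (Fin N) => x i, fun x => x j; μ] = A⁻¹ i j
  subGaussian : ∀ i, HasSubgaussianMGF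
    (fun x : EuclideanSpace ℝ (Fin N) => x i / Real.sqrt (A⁻¹ i i)) (σ ^ 2) μ

/-- The samples `X` follow a family of random `N`-dimensional multivariate sub-Gaussian
distributions of size `K` with parameter `σ`, true common precision matrix `A` and random
deviations `Δ`. Given the precision matrices `A + Δ^(k)`, the samples are independent, and those of
task `k` have the common law `law k (A + Δ^(k))`. -/
structure IsRandomSubGaussianFamily {Ω : Type*} [MeasurableSpace Ω] {N K n : ℕ} (P : Measure Ω)
    (A : Matrix (Fin N) (Fin N) ℝ) (Δ : Ω → Fin K → Coupling N) (X : Ω → Data N K n)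
    (σ : ℝ≥0) : Prop where
  posDef : A.PosDef
  measurable_dev : Measurable Δ
  measurable_data : Measurable X
  indep : iIndepFun (fun k ω => Δ ω k) P
  identDistrib : ∀ k l, IdentDistrib (fun ω => Δ ω k) (fun ω => Δ ω l) P P
  bounds : ∃ γ cmax : ℝ, 0 < γ ∧ 0 < cmax ∧ (∀ r ∈ spectrum ℝ A, cmax ≤ r / 2) ∧
    ∀ᵐ ω ∂P, ∀ k, (A + Matrix.of (Δ ω k)).PosDef ∧
      matSupport (Matrix.of (Δ ω k)) ⊆ matSupport A ∧
      (∀ i j, |(A + Matrix.of (Δ ω k))⁻¹ i j| ≤ γ) ∧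
      ‖Matrix.toEuclideanCLM (𝕜 := ℝ) (Matrix.of (Δ ω k))‖ ≤ cmax
  integrable_inv : ∀ k i j, Integrable (fun ω => (A + Matrix.of (Δ ω k))⁻¹ i j) P
  samples : ∃ law : Fin K → Matrix (Fin N) (Fin N) ℝ → Measure (EuclideanSpace ℝ (Fin N)),
    (∀ᵐ ω ∂P, ∀ k, IsSubGaussianVector (law k (A + Matrix.of (Δ ω k)))
      (A + Matrix.of (Δ ω k)) σ) ∧
    ∀ (B : Set (Fin K → Coupling N)) (C : Set (Data N K n)), MeasurableSet B → MeasurableSet C →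
      P (Δ ⁻¹' B ∩ X ⁻¹' C) = ∫⁻ ω in Δ ⁻¹' B,
        Measure.pi (fun k => Measure.pi fun _ : Fin n => law k (A + Matrix.of (Δ ω k))) C ∂P

/-- The centred Gaussian law with covariance `(I + H ⊙ Q)⁻¹`. -/
def gaussianLaw {N : ℕ} (d : ℕ) (π : Equiv.Perm (Fin N)) (q : Coupling N) :
    Measure (EuclideanSpace ℝ (Fin N)) :=
  multivariateGaussian 0 (precision d π q)⁻¹

/-- The random experiment: `π` is a uniform random permutation, the matrices `Q^(1), …, Q^(K)` are
independent of `π` and almost surely symmetric with entries in `[-1/(2d), 1/(2d)]` (their joint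
law is otherwise arbitrary; they may be deterministic), and given `π` and `Q` all samples are
independent, the `n` samples of task `k` being Gaussian with covariance `(I + H ⊙ Q^(k))⁻¹`. -/
structure IsExperiment {Ω : Type*} [MeasurableSpace Ω] {N K n : ℕ} (d : ℕ) (P : Measure Ω)
    (π : Ω → Equiv.Perm (Fin N)) (Q : Ω → Fin K → Coupling N) (X : Ω → Data N K n) : Prop where
  measurable_perm : Measurable π
  measurable_coupling : Measurable Q
  measurable_data : Measurable X
  uniform : ∀ τ : Equiv.Perm (Fin N), P {ω | π ω = τ} = ((N ! : ℕ) : ℝ≥0∞)⁻¹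
  indep : IndepFun π Q P
  mem_box : ∀ᵐ ω ∂P, ∀ k, Q ω k ∈ couplingBox N d
  samples : ∀ (τ : Equiv.Perm (Fin N)) (B : Set (Fin K → Coupling N)) (C : Set (Data N K n)),
    MeasurableSet B → MeasurableSet C →
      P ({ω | π ω = τ} ∩ Q ⁻¹' B ∩ X ⁻¹' C) = ∫⁻ ω in {ω | π ω = τ} ∩ Q ⁻¹' B,
        Measure.pi (fun k => Measure.pi fun _ : Fin n => gaussianLaw d τ (Q ω k)) C ∂P

/-- `S'` is an estimate of the support union: a measurable function of the data, possibly also of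
the matrices `Q^(k)` and of external randomness `U` independent of everything else. -/
structure IsEstimate {Ω 𝓤 : Type*} [MeasurableSpace Ω] [MeasurableSpace 𝓤] {N K n : ℕ}
    (P : Measure Ω) (π : Ω → Equiv.Perm (Fin N)) (Q : Ω → Fin K → Coupling N)
    (X : Ω → Data N K n) (U : Ω → 𝓤) (S' : Ω → Set (Fin N × Fin N)) : Prop where
  measurable_rand : Measurable U
  indep : IndepFun U (fun ω => (π ω, Q ω, X ω)) P
  factors : ∃ s : Data N K n × (Fin K → Coupling N) × 𝓤 → Set (Fin N × Fin N),
    Measurable s ∧ ∀ ω, S' ω = s (X ω, Q ω, U ω)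

end SupportUnion

end

namespace SupportUnion

/-! The lower bound is Fano's inequality with the standard Gaussian law ν of the whole data set as
reference. For a law μ and an event A, the Donsker–Varadhan inequality reads t·μ(A) ≤ KL(μ‖ν) +
log(1 + (e^t − 1)ν(A)). `mul_measureReal_le_of_withDensity` proves it with the logarithm replaced by
a tangent line, so that the right side is affine in ν(A) and can be summed over permutations. Since
ν does not depend on the permutation, the output at a given data point is correct only for the
permutations in one fibre of τ ↦ `supportUnion d τ`. If every fibre has at most N!/M elements, the
average of ν(A) is therefore at most 1/M, and t = log M gives success · log M < nK·N/(4d) + log 2.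

The information term comes from `integral_log_gaussianDensity_le`. The precision matrix A has trace
N and satisfies A ≥ 1/2 by diagonal dominance, so one sample has relative entropy at most the
squared Frobenius norm of A − 1. That norm has Nd nonzero terms, each at most 1/(4d²).

The counting term is a rigidity statement. For d + 3 ≤ N the graph is a power of a cycle from which
the cycle can be recovered, so fibres have at most 2N elements (`card_fibre_le`) and M = N!/(2N),
which Stirling's bound turns into the stated denominator. For d + 2 = N the graph only records the
matching of antipodal positions, and `card_fibre_mul_le` gives just M = (N/2)!. The same denominator
survives because the information per sample is then at most 3/8 instead of N; with no samples at all
a cruder choice of t is enough.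

All estimates are uniform in the coupling matrices, so `IsEstimate.measure_success_le` can freeze Q
and the external randomness by Fubini. -/

/-! ### Densities of products and of Gaussian laws. -/

lemma lintegral_pi_prod {E : Type*} [MeasurableSpace E] {n : ℕ} (μ : Fin n → Measure E)
    [∀ i, SigmaFinite (μ i)] (f : Fin n → E → ℝ≥0∞) (hf : ∀ i, Measurable (f i)) :
    ∫⁻ x, ∏ i, f i (x i) ∂Measure.pi μ = ∏ i, ∫⁻ x, f i x ∂μ i := by
  induction n with
  | zero => simp
  | succ n ih =>
    rw [← (measurePreserving_piFinSuccAbove μ 0).symm.lintegral_comp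
      (by fun_prop), Fin.prod_univ_succ, ← ih (fun j => μ j.succ) _ (fun j => hf j.succ),
      ← lintegral_prod_mul (hf 0).aemeasurable
        (Finset.measurable_prod _ fun j _ => (hf j.succ).comp (measurable_pi_apply j)).aemeasurable]
    simp [MeasurableEquiv.piFinSuccAbove_symm_apply, Fin.insertNthEquiv, Fin.prod_univ_succ]

lemma pi_withDensity {E : Type*} [MeasurableSpace E] {n : ℕ} (μ : Fin n → Measure E)
    [∀ i, SigmaFinite (μ i)] (f : Fin n → E → ℝ≥0∞) (hf : ∀ i, Measurable (f i))
    [∀ i, SigmaFinite ((μ i).withDensity (f i))] :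
    Measure.pi (fun i => (μ i).withDensity (f i)) =
      (Measure.pi μ).withDensity fun x => ∏ i, f i (x i) := by
  refine Measure.pi_eq fun s hs => ?_
  rw [withDensity_apply _ (MeasurableSet.univ_pi hs), ← lintegral_indicator (MeasurableSet.univ_pi hs)]
  have : (Set.univ.pi s).indicator (fun x : Fin n → E => ∏ i, f i (x i)) =
      fun x => ∏ i, (s i).indicator (f i) (x i) := by
    ext x
    by_cases hx : x ∈ Set.univ.pi s
    · rw [Set.indicator_of_mem hx]
      exact Finset.prod_congr rfl fun i _ => (Set.indicator_of_mem (hx i trivial) _).symm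
    · rw [Set.indicator_of_notMem hx]
      obtain ⟨i, hi⟩ : ∃ i, x i ∉ s i := by simpa using hx
      exact (Finset.prod_eq_zero (Finset.mem_univ i) (Set.indicator_of_notMem hi _)).symm
  rw [this, lintegral_pi_prod μ _ fun i => (hf i).indicator (hs i)]
  refine Finset.prod_congr rfl fun i _ => ?_
  rw [withDensity_apply _ (hs i), lintegral_indicator (hs i)]

lemma map_withDensity_equiv {α β : Type*} [MeasurableSpace α] [MeasurableSpace β] (e : α ≃ᵐ β)
    (μ : Measure α) (f : α → ℝ≥0∞) :
    (μ.withDensity f).map e = (μ.map e).withDensity (f ∘ e.symm) := by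
  ext s hs
  rw [e.map_apply, withDensity_apply _ (e.measurable hs), withDensity_apply _ hs,
    Measure.restrict_map e.measurable hs, lintegral_map_equiv]
  simp

/-- The Lebesgue density of the standard Gaussian measure. -/
noncomputable def stdGaussianPDF {N : ℕ} (x : EuclideanSpace ℝ (Fin N)) : ℝ :=
  (Real.sqrt (2 * Real.pi))⁻¹ ^ N * Real.exp (-(x.ofLp ⬝ᵥ x.ofLp) / 2)

lemma stdGaussian_eq_withDensity (N : ℕ) :
    stdGaussian (EuclideanSpace ℝ (Fin N)) =
      volume.withDensity fun x => ENNReal.ofReal (stdGaussianPDF x) := by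
  have hg : gaussianReal 0 1 = volume.withDensity (gaussianPDF 0 1) :=
    gaussianReal_of_var_ne_zero 0 one_ne_zero
  have : SigmaFinite ((volume : Measure ℝ).withDensity (gaussianPDF 0 1)) := by
    rw [← hg]; infer_instance
  rw [← map_pi_eq_stdGaussian, hg, pi_withDensity _ _ fun _ => measurable_gaussianPDF 0 1]
  have := map_withDensity_equiv (MeasurableEquiv.toLp 2 (Fin N → ℝ))
    (Measure.pi fun _ => (volume : Measure ℝ)) (fun x => ∏ i, gaussianPDF 0 1 (x i))
  rw [MeasurableEquiv.coe_toLp] at this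
  rw [this, ← volume_pi, (PiLp.volume_preserving_toLp (Fin N)).map_eq]
  congr 1
  ext x
  simp only [Function.comp_apply, gaussianPDF]
  rw [← ENNReal.ofReal_prod_of_nonneg fun i _ => gaussianPDFReal_nonneg _ _ _]
  congr 1
  simp [gaussianPDFReal, stdGaussianPDF, Finset.prod_mul_distrib, dotProduct, ← Real.exp_sum,
    Finset.sum_div, neg_div, sq]

/-- The density of the centred Gaussian measure with precision matrix `A` with respect to the
standard Gaussian measure. -/
noncomputable def gaussianDensity {N : ℕ} (A : Matrix (Fin N) (Fin N) ℝ) (x : EuclideanSpace ℝ (Fin N)) : ℝ :=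
  Real.sqrt A.det * Real.exp (-(x.ofLp ⬝ᵥ ((A - 1) *ᵥ x.ofLp)) / 2)


lemma gaussianDensity_pos {N : ℕ} {A : Matrix (Fin N) (Fin N) ℝ} (hA : A.PosDef)
    (x : EuclideanSpace ℝ (Fin N)) : 0 < gaussianDensity A x :=
  mul_pos (Real.sqrt_pos.2 hA.det_pos) (Real.exp_pos _)

open scoped MatrixOrder in
-- Change of variables under the symmetric root R of A⁻¹: since R⁻¹R⁻¹ = A, the form |x|² becomes
-- yᵀAy, and the Jacobian factor |det R|⁻¹ equals √(det A).
lemma multivariateGaussian_inv_eq_withDensity {N : ℕ} {A : Matrix (Fin N) (Fin N) ℝ}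
    (hA : A.PosDef) :
    multivariateGaussian 0 A⁻¹ = (stdGaussian (EuclideanSpace ℝ (Fin N))).withDensity
      fun x => ENNReal.ofReal (gaussianDensity A x) := by
  set R := CFC.sqrt A⁻¹ with hR
  have hRR : R * R = A⁻¹ := CFC.sqrt_mul_sqrt_self _ hA.inv.posSemidef.nonneg
  have hRs : Rᵀ = R := by
    have := (CFC.sqrt_nonneg A⁻¹).isSelfAdjoint
    rwa [IsSelfAdjoint, Matrix.star_eq_conjTranspose, Matrix.conjTranspose_eq_transpose_of_trivial]
      at this
  have hdet : A.det * R.det ^ 2 = 1 := by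
    rw [sq, ← Matrix.det_mul, hRR, ← Matrix.det_mul, Matrix.mul_nonsing_inv _ hA.det_pos.ne'.isUnit,
      Matrix.det_one]
  have hR0 : R.det ≠ 0 := by
    intro h; simp [h] at hdet
  have hRu : IsUnit R.det := hR0.isUnit
  have hinv : R⁻¹ * R⁻¹ = A := by
    rw [← Matrix.mul_inv_rev, hRR, Matrix.nonsing_inv_nonsing_inv _ hA.det_pos.ne'.isUnit]
  have hinvs : R⁻¹ᵀ = R⁻¹ := by rw [Matrix.transpose_nonsing_inv, hRs]
  let e : EuclideanSpace ℝ (Fin N) ≃L[ℝ] EuclideanSpace ℝ (Fin N) :=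
    ContinuousLinearEquiv.equivOfInverse (Matrix.toEuclideanCLM (𝕜 := ℝ) R)
      (Matrix.toEuclideanCLM (𝕜 := ℝ) R⁻¹)
      (fun x => by
        rw [← mul_apply_eq_comp, ← map_mul, Matrix.nonsing_inv_mul _ hRu, map_one]
        rfl)
      (fun x => by
        rw [← mul_apply_eq_comp, ← map_mul, Matrix.mul_nonsing_inv _ hRu, map_one]
        rfl)
  let m : EuclideanSpace ℝ (Fin N) ≃ᵐ EuclideanSpace ℝ (Fin N) := e.toHomeomorph.toMeasurableEquiv
  have hm : (multivariateGaussian 0 A⁻¹) = (stdGaussian (EuclideanSpace ℝ (Fin N))).map m := by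
    rw [multivariateGaussian]
    congr 1
    ext x
    simp [m, e, hR]
  have hvol : (volume : Measure (EuclideanSpace ℝ (Fin N))).map m =
      ENNReal.ofReal |R.det⁻¹| • volume := by
    have := Measure.map_linearMap_addHaar_eq_smul_addHaar
      (volume : Measure (EuclideanSpace ℝ (Fin N))) (f := Matrix.toLpLin 2 2 R)
      (by rwa [LinearMap.det_toLpLin])
    rw [LinearMap.det_toLpLin] at this
    rw [← this]
    rfl
  have hmeas : Measurable fun x : EuclideanSpace ℝ (Fin N) => ENNReal.ofReal (stdGaussianPDF x) := by
    unfold stdGaussianPDF dotProduct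
    fun_prop
  have hmeas' : Measurable fun x : EuclideanSpace ℝ (Fin N) =>
      ENNReal.ofReal (gaussianDensity A x) := by
    unfold gaussianDensity dotProduct Matrix.mulVec dotProduct
    fun_prop
  rw [hm, stdGaussian_eq_withDensity, map_withDensity_equiv, hvol, withDensity_smul_measure,
    ← withDensity_smul _ (hmeas.comp m.symm.measurable), ← withDensity_mul _ hmeas hmeas']
  congr 1
  ext y
  have hsymm : (m.symm y).ofLp = R⁻¹ *ᵥ y.ofLp := Matrix.ofLp_toEuclideanCLM R⁻¹ y
  have hq : (m.symm y).ofLp ⬝ᵥ (m.symm y).ofLp = y.ofLp ⬝ᵥ (A *ᵥ y.ofLp) := by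
    rw [hsymm, Matrix.dotProduct_mulVec, ← Matrix.mulVec_transpose, hinvs, Matrix.mulVec_mulVec,
      hinv, dotProduct_comm]
  have hd : |R.det⁻¹| = Real.sqrt A.det := by
    rw [← Real.sqrt_sq_eq_abs]
    congr 1
    field_simp
    linarith
  simp only [Pi.smul_apply, Pi.mul_apply, Function.comp_apply, smul_eq_mul]
  rw [← ENNReal.ofReal_mul (abs_nonneg _), ← ENNReal.ofReal_mul (by unfold stdGaussianPDF; positivity)]
  congr 1
  rw [stdGaussianPDF, stdGaussianPDF, gaussianDensity, hq, hd, Matrix.sub_mulVec,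
    dotProduct_sub, Matrix.one_mulVec]
  have : Real.exp (-(y.ofLp ⬝ᵥ A *ᵥ y.ofLp) / 2) = Real.exp (-(y.ofLp ⬝ᵥ y.ofLp) / 2) *
      Real.exp (-(y.ofLp ⬝ᵥ A *ᵥ y.ofLp - y.ofLp ⬝ᵥ y.ofLp) / 2) := by
    rw [← Real.exp_add]; congr 1; ring
  rw [this]; ring

/-! ### Gaussian moments and relative entropy from the standard Gaussian. -/

lemma memLp_eval_multivariateGaussian {N : ℕ} (S : Matrix (Fin N) (Fin N) ℝ) (i : Fin N) :
    MemLp (fun x : EuclideanSpace ℝ (Fin N) => x i) 2 (multivariateGaussian 0 S) :=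
  (IsGaussian.memLp_two_id (μ := multivariateGaussian 0 S)).continuousLinearMap_comp
    (EuclideanSpace.proj (𝕜 := ℝ) i)

lemma integral_eval_multivariateGaussian {N : ℕ} (S : Matrix (Fin N) (Fin N) ℝ) (i : Fin N) :
    ∫ x, x i ∂multivariateGaussian 0 S = 0 := by
  have := (EuclideanSpace.proj (𝕜 := ℝ) i).integral_comp_id_comm
    (IsGaussian.integrable_id (μ := multivariateGaussian (0 : EuclideanSpace ℝ (Fin N)) S))
  simpa using this

lemma integral_mul_multivariateGaussian {N : ℕ} {S : Matrix (Fin N) (Fin N) ℝ} (hS : S.PosSemidef)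
    (i j : Fin N) : ∫ x, x i * x j ∂multivariateGaussian 0 S = S i j := by
  rw [← covariance_eval_multivariateGaussian (μ := 0) hS i j,
    covariance_eq_sub (memLp_eval_multivariateGaussian S i) (memLp_eval_multivariateGaussian S j)]
  simp [integral_eval_multivariateGaussian]

lemma log_gaussianDensity {N : ℕ} {A : Matrix (Fin N) (Fin N) ℝ} (hA : A.PosDef)
    (x : EuclideanSpace ℝ (Fin N)) :
    Real.log (gaussianDensity A x) =
      Real.log A.det / 2 - (∑ i, ∑ j, (A - 1) i j * (x i * x j)) / 2 := by
  rw [gaussianDensity, Real.log_mul (Real.sqrt_pos.2 hA.det_pos).ne' (Real.exp_pos _).ne',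
    Real.log_exp, Real.log_sqrt hA.det_pos.le, neg_div, ← sub_eq_add_neg]
  congr 2
  simp only [dotProduct, Matrix.mulVec, Finset.mul_sum]
  exact Finset.sum_congr rfl fun i _ => Finset.sum_congr rfl fun j _ => by ring

lemma integrable_mul_multivariateGaussian {N : ℕ} (S : Matrix (Fin N) (Fin N) ℝ) (i j : Fin N) :
    Integrable (fun x : EuclideanSpace ℝ (Fin N) => x i * x j) (multivariateGaussian 0 S) :=
  (memLp_eval_multivariateGaussian S i).integrable_mul (memLp_eval_multivariateGaussian S j)

lemma integrable_log_gaussianDensity {N : ℕ} {A : Matrix (Fin N) (Fin N) ℝ} (hA : A.PosDef) :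
    Integrable (fun x => Real.log (gaussianDensity A x)) (multivariateGaussian 0 A⁻¹) := by
  simp_rw [log_gaussianDensity hA]
  refine (integrable_const _).sub (Integrable.div_const ?_ _)
  exact integrable_finsetSum _ fun i _ => integrable_finsetSum _ fun j _ =>
    (integrable_mul_multivariateGaussian _ i j).const_mul _

/-- This is the relative entropy from the standard Gaussian. Second moments A⁻¹ turn the quadratic
form into tr((A − 1)A⁻¹) = N − tr A⁻¹. -/
lemma integral_log_gaussianDensity {N : ℕ} {A : Matrix (Fin N) (Fin N) ℝ} (hA : A.PosDef) :
    ∫ x, Real.log (gaussianDensity A x) ∂multivariateGaussian 0 A⁻¹ =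
      Real.log A.det / 2 - (N - A⁻¹.trace) / 2 := by
  have hint (i j : Fin N) := (integrable_mul_multivariateGaussian A⁻¹ i j).const_mul ((A - 1) i j)
  have hint' (i : Fin N) := integrable_finsetSum Finset.univ fun j _ => hint i j
  have hsum : ∫ x : EuclideanSpace ℝ (Fin N), ∑ i, ∑ j, (A - 1) i j * (x i * x j)
      ∂multivariateGaussian 0 A⁻¹ = ∑ i, ∑ j, (A - 1) i j * A⁻¹ i j := by
    rw [integral_finsetSum _ fun i _ => hint' i]
    refine Finset.sum_congr rfl fun i _ => ?_
    rw [integral_finsetSum _ fun j _ => hint i j]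
    refine Finset.sum_congr rfl fun j _ => ?_
    rw [integral_const_mul, integral_mul_multivariateGaussian hA.inv.posSemidef]
  simp_rw [log_gaussianDensity hA]
  rw [integral_sub (integrable_const _) ((integrable_finsetSum _ fun i _ => hint' i).div_const _),
    integral_div _ (fun x : EuclideanSpace ℝ (Fin N) => ∑ i, ∑ j, (A - 1) i j * (x i * x j)), hsum]
  have h : ∑ i, ∑ j, (A - 1) i j * A⁻¹ i j = ((A - 1) * A⁻¹).trace := by
    simp only [Matrix.trace, Matrix.diag, Matrix.mul_apply]
    refine Finset.sum_congr rfl fun i _ => Finset.sum_congr rfl fun j _ => ?_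
    rw [← hA.inv.isHermitian.apply i j]; simp
  rw [h, sub_mul, Matrix.mul_nonsing_inv _ hA.det_pos.ne'.isUnit]
  simp

lemma log_det_le_trace_sub {N : ℕ} {A : Matrix (Fin N) (Fin N) ℝ} (hA : A.PosDef) :
    Real.log A.det ≤ A.trace - N := by
  rw [hA.isHermitian.det_eq_prod_eigenvalues, hA.isHermitian.trace_eq_sum_eigenvalues]
  simp only [RCLike.ofReal_real_eq_id, id]
  rw [Real.log_prod fun i _ => (hA.eigenvalues_pos i).ne']
  calc _ ≤ ∑ i, (hA.isHermitian.eigenvalues i - 1) :=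
        Finset.sum_le_sum fun i _ => Real.log_le_sub_one_of_pos (hA.eigenvalues_pos i)
    _ = _ := by simp

lemma four_mul_dotProduct_le {N : ℕ} (y b : Fin N → ℝ) :
    4 * (y ⬝ᵥ b) ≤ y ⬝ᵥ y + 4 * (b ⬝ᵥ b) := by
  simp only [dotProduct, Finset.mul_sum, ← Finset.sum_add_distrib]
  exact Finset.sum_le_sum fun i _ => by nlinarith [sq_nonneg (y i - 2 * b i)]

/-- With y = A⁻¹b, the lower bound A ≥ 1/2 gives |y|²/2 ≤ y·b, and y·b ≤ |y|²/4 + |b|². No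
diagonalisation is needed. -/
lemma dotProduct_inv_mulVec_self_le {N : ℕ} {A : Matrix (Fin N) (Fin N) ℝ} (hA : A.PosDef)
    (hlow : ∀ x, x ⬝ᵥ x / 2 ≤ x ⬝ᵥ A *ᵥ x) (b : Fin N → ℝ) :
    (A⁻¹ *ᵥ b) ⬝ᵥ (A⁻¹ *ᵥ b) ≤ 4 * (b ⬝ᵥ b) := by
  set y := A⁻¹ *ᵥ b with hy
  have hAy : A *ᵥ y = b := by
    rw [hy, Matrix.mulVec_mulVec, Matrix.mul_nonsing_inv _ hA.det_pos.ne'.isUnit,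
      Matrix.one_mulVec]
  have h1 := hlow y
  rw [hAy] at h1
  linarith [four_mul_dotProduct_le y b]

lemma dotProduct_inv_mulVec_le {N : ℕ} {A : Matrix (Fin N) (Fin N) ℝ} (hA : A.PosDef)
    (hlow : ∀ x, x ⬝ᵥ x / 2 ≤ x ⬝ᵥ A *ᵥ x) (b : Fin N → ℝ) :
    b ⬝ᵥ (A⁻¹ *ᵥ b) ≤ 2 * (b ⬝ᵥ b) := by
  have h1 := dotProduct_inv_mulVec_self_le hA hlow b
  set y := A⁻¹ *ᵥ b
  linarith [four_mul_dotProduct_le y b, dotProduct_comm y b]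

lemma abs_inv_apply_le {N : ℕ} {A : Matrix (Fin N) (Fin N) ℝ} (hA : A.PosDef)
    (hlow : ∀ x, x ⬝ᵥ x / 2 ≤ x ⬝ᵥ A *ᵥ x) (i j : Fin N) : |A⁻¹ i j| ≤ 2 := by
  have h := dotProduct_inv_mulVec_self_le hA hlow (Pi.single j 1)
  rw [Matrix.mulVec_single_one] at h
  have h2 : A⁻¹ i j ^ 2 ≤ A⁻¹.col j ⬝ᵥ A⁻¹.col j := by
    rw [sq]
    exact Finset.single_le_sum (f := fun i => A⁻¹.col j i * A⁻¹.col j i)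
      (fun i _ => mul_self_nonneg _) (Finset.mem_univ i)
  simp at h
  exact abs_le_of_sq_le_sq (by linarith) (by norm_num)

/-- The trace hypothesis removes the first-order terms: log det A ≤ tr A − N = 0, and tr A⁻¹ − N =
tr((A − 1)A⁻¹(A − 1)), which is quadratic in A − 1 and controlled by A⁻¹ ≤ 2. -/
lemma integral_log_gaussianDensity_le {N : ℕ} {A : Matrix (Fin N) (Fin N) ℝ} (hA : A.PosDef)
    (hlow : ∀ x, x ⬝ᵥ x / 2 ≤ x ⬝ᵥ A *ᵥ x) (htr : A.trace = N) :
    ∫ x, Real.log (gaussianDensity A x) ∂multivariateGaussian 0 A⁻¹ ≤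
      ∑ i, ∑ j, (A - 1) i j ^ 2 := by
  rw [integral_log_gaussianDensity hA]
  have h1 := log_det_le_trace_sub hA
  have hs : (A - 1)ᵀ = A - 1 := by
    have := hA.isHermitian.eq
    rw [Matrix.conjTranspose_eq_transpose_of_trivial] at this
    rw [Matrix.transpose_sub, this, Matrix.transpose_one]
  have hmul : (A - 1) * (A⁻¹ * (A - 1)) = A⁻¹ - 1 + (A - 1) := by
    rw [mul_sub A⁻¹, Matrix.nonsing_inv_mul _ hA.det_pos.ne'.isUnit, mul_sub, mul_one, mul_one,
      sub_mul, Matrix.mul_nonsing_inv _ hA.det_pos.ne'.isUnit, one_mul]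
    abel
  have h2 : A⁻¹.trace - N = ((A - 1) * (A⁻¹ * (A - 1))).trace := by
    rw [hmul]; simp [htr]
  have h3 : ((A - 1) * (A⁻¹ * (A - 1))).trace ≤ ∑ j, 2 * ∑ i, (A - 1) i j ^ 2 := by
    simp only [Matrix.trace, Matrix.diag]
    refine Finset.sum_le_sum fun j _ => ?_
    have := dotProduct_inv_mulVec_le hA hlow fun i => (A - 1) i j
    calc _ = (fun i => (A - 1) i j) ⬝ᵥ A⁻¹ *ᵥ fun i => (A - 1) i j := by
          rw [Matrix.mul_apply, dotProduct]
          refine Finset.sum_congr rfl fun i _ => ?_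
          rw [← Matrix.transpose_apply (A - 1), hs]
          rfl
      _ ≤ _ := this
      _ = _ := by simp [dotProduct, sq]
  rw [← Finset.mul_sum, Finset.sum_comm] at h3
  linarith

/-! ### Change of measure. -/

/-- A Fano-type change of measure inequality. -/
lemma mul_measureReal_le_of_withDensity {α : Type*} [MeasurableSpace α] {μ ν : Measure α}
    [IsProbabilityMeasure μ] [IsProbabilityMeasure ν] {f : α → ℝ} (hf : Measurable f)
    (hpos : ∀ x, 0 < f x) (hμ : μ = ν.withDensity fun x => ENNReal.ofReal (f x))
    (hint : Integrable (fun x => Real.log (f x)) μ) {A : Set α} (hA : MeasurableSet A) (t L : ℝ) :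
    t * μ.real A ≤ ∫ x, Real.log (f x) ∂μ +
      (1 + (Real.exp t - 1) * ν.real A) / Real.exp L - 1 + L := by
  have hexp : ∀ x, Real.exp (A.indicator (fun _ => t) x) =
      1 + A.indicator (fun _ => Real.exp t - 1) x := by
    intro x; by_cases hx : x ∈ A <;> simp [hx]
  have hpt : ∀ x, A.indicator (fun _ => t) x - Real.log (f x) ≤
      (f x)⁻¹ * (1 + A.indicator (fun _ => Real.exp t - 1) x) / Real.exp L - 1 + L := by
    intro x
    -- The exponential form of the tangent to the logarithm at e^L. Integrated against μ, the factor
    -- 1/f converts the right side into a ν-integral.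
    have h := Real.add_one_le_exp (A.indicator (fun _ => t) x - Real.log (f x) - L)
    rw [Real.exp_sub, Real.exp_sub, Real.exp_log (hpos x), hexp] at h
    have : (f x)⁻¹ * (1 + A.indicator (fun _ => Real.exp t - 1) x) =
      (1 + A.indicator (fun _ => Real.exp t - 1) x) / f x := by ring
    rw [this]; linarith
  have hiA : ∀ (ρ : Measure α) [IsProbabilityMeasure ρ] (c : ℝ),
      Integrable (A.indicator fun _ => c) ρ := fun ρ _ c => (integrable_const c).indicator hA
  have hi1 : Integrable (fun x => 1 + A.indicator (fun _ => Real.exp t - 1) x) ν :=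
    (integrable_const _).add (hiA ν _)
  have htop : ∀ᵐ x ∂ν, ENNReal.ofReal (f x) < ∞ := .of_forall fun x => ENNReal.ofReal_lt_top
  have hcancel : ∀ x, (ENNReal.ofReal (f x)).toReal •
      ((f x)⁻¹ * (1 + A.indicator (fun _ => Real.exp t - 1) x)) =
      1 + A.indicator (fun _ => Real.exp t - 1) x := by
    intro x
    rw [ENNReal.toReal_ofReal (hpos x).le, smul_eq_mul, mul_inv_cancel_left₀ (hpos x).ne']
  have hi2 : Integrable (fun x => (f x)⁻¹ * (1 + A.indicator (fun _ => Real.exp t - 1) x)) μ := by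
    rw [hμ, integrable_withDensity_iff_integrable_smul' (by fun_prop) htop]
    simpa only [hcancel] using hi1
  have hI2 : ∫ x, (f x)⁻¹ * (1 + A.indicator (fun _ => Real.exp t - 1) x) ∂μ =
      1 + (Real.exp t - 1) * ν.real A := by
    rw [hμ, integral_withDensity_eq_integral_toReal_smul (by fun_prop) htop]
    simp_rw [hcancel]
    rw [integral_add (integrable_const _) (hiA ν _), integral_indicator_const _ hA]
    simp [mul_comm]
  have hi3 : Integrable (fun x =>
      (f x)⁻¹ * (1 + A.indicator (fun _ => Real.exp t - 1) x) / Real.exp L - 1) μ :=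
    (hi2.div_const (Real.exp L)).sub (integrable_const 1)
  have := integral_mono ((hiA μ t).sub hint) (hi3.add (integrable_const L)) hpt
  rw [integral_sub' (hiA μ t) hint, integral_add' hi3 (integrable_const _),
    integral_sub (hi2.div_const (Real.exp L)) (integrable_const 1), integral_div, hI2,
    integral_indicator_const _ hA] at this
  simp at this
  linarith

/-! ### Rigidity of powers of a cycle, and the size of the fibres. -/

/-- The closed neighbourhood of `0` in the graph on the cycle joining positions at distance at
most `k`. -/
def Near {N : ℕ} (k : ℕ) (v : Fin N) : Prop := v.val ≤ k ∨ N ≤ v.val + k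

lemma val_sub_eq {N : ℕ} (a b : Fin N) :
    (a - b).val = if b.val ≤ a.val then a.val - b.val else N + a.val - b.val := by
  rw [Fin.val_sub]
  split_ifs with h
  · rw [show N - b.val + a.val = a.val - b.val + N by omega, Nat.add_mod_right,
      Nat.mod_eq_of_lt (by omega)]
  · rw [Nat.mod_eq_of_lt (by omega)]; omega

lemma eq_cyclicShift_iff {N : ℕ} (i j : Fin N) {m : ℕ} (hm : m < N) :
    j = cyclicShift i m ↔ (j - i).val = m := by
  rw [val_sub_eq, Fin.ext_iff, cyclicShift]
  have hi := i.isLt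
  have hj := j.isLt
  by_cases h : i.val + m < N
  · simp only [Nat.mod_eq_of_lt h]; split_ifs <;> omega
  · have : (i.val + m) % N = i.val + m - N := by
      rw [Nat.mod_eq_sub_mod (by omega), Nat.mod_eq_of_lt (by omega)]
    simp only [this]; split_ifs <;> omega

lemma mem_edgeSet_iff {N d : ℕ} (hd : d + 2 ≤ N) (π : Equiv.Perm (Fin N)) (i j : Fin N) :
    (π i, π j) ∈ edgeSet d π ↔ i ≠ j ∧ Near (d / 2) (j - i) := by
  have hi := i.isLt
  have hj := j.isLt
  have hij : i ≠ j ↔ i.val ≠ j.val := by rw [Ne, Fin.ext_iff]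
  simp only [edgeSet, Set.mem_ofPred_eq, Prod.mk.injEq, EmbeddingLike.apply_eq_iff_eq, Near, hij]
  constructor
  · rintro ⟨a, m, hm1, hm2, ⟨rfl, h⟩ | ⟨h, rfl⟩⟩ <;>
    · rw [eq_cyclicShift_iff _ _ (by omega), val_sub_eq] at h
      rw [val_sub_eq]
      split_ifs at h ⊢ <;> omega
  · rintro ⟨h1, h2 | h2⟩
    · refine ⟨i, (j - i).val, ?_, h2, Or.inl ⟨rfl, ?_⟩⟩
      · rw [val_sub_eq] at h2 ⊢; split_ifs at h2 ⊢ <;> omega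
      · rw [eq_cyclicShift_iff _ _ (j - i).isLt]
    · refine ⟨j, (i - j).val, ?_, ?_, Or.inr ⟨?_, rfl⟩⟩
      · rw [val_sub_eq] at h2 ⊢; split_ifs at h2 ⊢ <;> omega
      · rw [val_sub_eq] at h2 ⊢; split_ifs at h2 ⊢ <;> omega
      · rw [eq_cyclicShift_iff _ _ (i - j).isLt]

lemma card_near {N k : ℕ} (hk : 2 * k + 2 ≤ N) :
    {v : Fin N | v.val ≠ 0 ∧ Near k v}.ncard = 2 * k := by
  have h : (fun v : Fin N => v.val) '' {v : Fin N | v.val ≠ 0 ∧ Near k v} =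
      ((Finset.Icc 1 k ∪ Finset.Ico (N - k) N : Finset ℕ) : Set ℕ) := by
    ext m
    simp only [Set.mem_image, Set.mem_ofPred_eq, Near, Finset.coe_union, Finset.coe_Icc,
      Finset.coe_Ico, Set.mem_union, Set.mem_Icc, Set.mem_Ico]
    constructor
    · rintro ⟨v, hv, rfl⟩
      have := v.isLt
      omega
    · intro hm
      exact ⟨⟨m, by omega⟩, by simp only; omega, rfl⟩
  rw [← Set.ncard_image_of_injective _ Fin.val_injective, h, Set.ncard_coe_finset,
    Finset.card_union_of_disjoint]
  · simp; omega
  · rw [Finset.disjoint_left]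
    intro m; simp only [Finset.mem_Icc, Finset.mem_Ico]; omega

lemma ncard_neighbours {N d : ℕ} (hd2 : Even d) (hd : d + 2 ≤ N) (π : Equiv.Perm (Fin N))
    (a : Fin N) : {b | (a, b) ∈ edgeSet d π}.ncard = d := by
  have : NeZero N := ⟨by omega⟩
  have h : {b | (a, b) ∈ edgeSet d π} =
      (fun v => π (π.symm a + v)) '' {v : Fin N | v.val ≠ 0 ∧ Near (d / 2) v} := by
    ext b
    have := mem_edgeSet_iff hd π (π.symm a) (π.symm b)
    simp only [Equiv.apply_symm_apply] at this
    simp only [Set.mem_ofPred_eq, this, Set.mem_image]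
    constructor
    · rintro ⟨h1, h2⟩
      refine ⟨π.symm b - π.symm a, ⟨?_, h2⟩, by simp⟩
      rw [Fin.val_ne_zero_iff, sub_ne_zero]
      exact h1.symm
    · rintro ⟨v, ⟨h1, h2⟩, rfl⟩
      rw [Fin.val_ne_zero_iff] at h1
      simpa using ⟨h1, h2⟩
  have hinj : Function.Injective fun v => π (π.symm a + v) :=
    π.injective.comp (add_right_injective _)
  rw [h, Set.ncard_image_of_injective _ hinj, card_near (by omega)]
  obtain ⟨r, rfl⟩ := hd2
  omega

lemma supportUnion_eq_iff {N d : ℕ} (hd : d + 2 ≤ N) {π τ : Equiv.Perm (Fin N)}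
    (h : supportUnion d π = supportUnion d τ) (i j : Fin N) :
    Near (d / 2) (j - i) ↔ Near (d / 2) (τ.symm (π j) - τ.symm (π i)) := by
  have : NeZero N := ⟨by omega⟩
  by_cases hij : i = j
  · subst hij; simp [Near]
  have h1 := mem_edgeSet_iff hd π i j
  have h2 := mem_edgeSet_iff hd τ (τ.symm (π i)) (τ.symm (π j))
  have h3 : (π i, π j) ∈ supportUnion d π ↔ (π i, π j) ∈ supportUnion d τ := by rw [h]
  simp only [supportUnion, Set.mem_union, Set.mem_ofPred_eq, EmbeddingLike.apply_eq_iff_eq, hij,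
    or_false] at h3
  simp only [Equiv.apply_symm_apply] at h2
  rw [h1, h2] at h3
  simpa [hij] using h3

/-- Two vertices whose closed neighbourhoods differ by at most one point must be consecutive on the
cycle. For any other `v`, each case exhibits two points near 0 and far from `v`. With
`near_diff_of_unit_step` this makes cyclic adjacency a property of the graph alone. -/
lemma unit_step_of_near_diff {N k : ℕ} (hk : 1 ≤ k) (hN : 2 * k + 3 ≤ N) (v : Fin N) (hv : v.val ≠ 0)
    (h : ∀ x y : Fin N, Near k x → ¬ Near k (x - v) → Near k y → ¬ Near k (y - v) → x = y) :
    v.val = 1 ∨ v.val + 1 = N := by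
  have hvN := v.isLt
  by_contra hcon
  have key : ∀ a b : ℕ, ∀ ha : a < N, ∀ hb : b < N, a ≠ b →
      Near k (⟨a, ha⟩ : Fin N) → ¬ Near k ((⟨a, ha⟩ : Fin N) - v) →
      Near k (⟨b, hb⟩ : Fin N) → ¬ Near k ((⟨b, hb⟩ : Fin N) - v) → False := by
    intro a b ha hb hab h1 h2 h3 h4
    have := h _ _ h1 h2 h3 h4
    simp only [Fin.mk.injEq] at this
    exact hab this
  simp only [Near, val_sub_eq] at key
  -- The witnesses are the two extreme points −k, −k + 1 of the arc around 0, on the side away from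
  -- `v`; the next case is the mirror image.
  by_cases h1 : v.val ≤ N - 2 * k - 1
  · by_cases hk1 : k = 1
    · refine key (N - k) 0 (by omega) (by omega) (by omega) ?_ ?_ ?_ ?_ <;>
      (try split_ifs) <;> omega
    · refine key (N - k) (N - k + 1) (by omega) (by omega) (by omega) ?_ ?_ ?_ ?_ <;>
      (try split_ifs) <;> omega
  by_cases h2 : N - v.val ≤ N - 2 * k - 1
  · refine key k (k - 1) (by omega) (by omega) (by omega) ?_ ?_ ?_ ?_ <;>
      (try split_ifs) <;> omega
  -- Here the arcs around 0 and `v` meet on both sides. The witnesses are v − k − 1 and v − k − 2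
  -- modulo N, just outside the arc around `v`; the remaining cases only separate the ways of
  -- wrapping around. That v − k − 2 is not reached from the other side uses 2k + 3 ≤ N.
  by_cases h3 : k + 2 ≤ v.val
  · refine key (v.val - k - 1) (v.val - k - 2) (by omega) (by omega) (by omega) ?_ ?_ ?_ ?_ <;>
      (try split_ifs) <;> omega
  by_cases h4 : k + 1 = v.val
  · refine key 0 (N - 1) (by omega) (by omega) (by omega) ?_ ?_ ?_ ?_ <;>
      (try split_ifs) <;> omega
  · refine key (N + v.val - k - 1) (N + v.val - k - 2) (by omega) (by omega) (by omega) ?_ ?_ ?_ ?_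
      <;>
      (try split_ifs) <;> omega

lemma near_diff_of_unit_step {N k : ℕ} (v : Fin N)
    (hv : v.val = 1 ∨ v.val + 1 = N) (x y : Fin N) (hx : Near k x) (hx' : ¬ Near k (x - v))
    (hy : Near k y) (hy' : ¬ Near k (y - v)) : x = y := by
  simp only [Near, val_sub_eq] at *
  ext
  rcases hv with hv | hv <;> split_ifs at hx' hy' <;> omega

section Fibre

open scoped Fin.CommRing

lemma val_eq_one_or_iff {N : ℕ} [NeZero N] (hN : 3 ≤ N) (v : Fin N) :
    (v.val = 1 ∨ v.val + 1 = N) ↔ (v = 1 ∨ v = -1) := by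
  have h1 : ((1 : Fin N).val) = 1 := by
    rw [Fin.val_one', Nat.mod_eq_of_lt (by omega)]
  have h2 : ((-1 : Fin N).val) = N - 1 := by
    rw [← zero_sub, val_sub_eq, h1]; simp
  rw [Fin.ext_iff, Fin.ext_iff, h1, h2]
  have := v.isLt
  omega

/-- The map z ↦ ρ⁻¹(z + ρ i) − i carries the neighbourhoods of 0 and ρ j − ρ i to those of 0 and j −
i, so the one-point-difference criterion passes from one pair to the other. -/
lemma unit_step_of_near_preserving {N k : ℕ} [NeZero N] (hk : 1 ≤ k) (hN : 2 * k + 3 ≤ N)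
    (ρ : Equiv.Perm (Fin N)) (hρ : ∀ i j, Near k (j - i) ↔ Near k (ρ j - ρ i)) (i j : Fin N)
    (hij : j - i = 1 ∨ j - i = -1) : ρ j - ρ i = 1 ∨ ρ j - ρ i = -1 := by
  rw [← val_eq_one_or_iff (by omega)] at hij ⊢
  refine unit_step_of_near_diff hk hN _ ?_ fun x y hx hx' hy hy' => ?_
  · rw [Fin.val_ne_zero_iff, sub_ne_zero, ρ.injective.ne_iff, ← sub_ne_zero,
      ← Fin.val_ne_zero_iff]
    omega
  · have e1 : ∀ z, Near k (ρ.symm (z + ρ i) - i) ↔ Near k z := fun z => by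
      rw [hρ, Equiv.apply_symm_apply, add_sub_cancel_right]
    have e2 : ∀ z, Near k (ρ.symm (z + ρ i) - i - (j - i)) ↔ Near k (z - (ρ j - ρ i)) := fun z => by
      rw [sub_sub_sub_cancel_right, hρ, Equiv.apply_symm_apply, sub_sub_eq_add_sub]
    have h := near_diff_of_unit_step (k := k) (j - i) hij _ _ ((e1 x).2 hx) (mt (e2 x).1 hx')
      ((e1 y).2 hy) (mt (e2 y).1 hy')
    simpa using h

/-- Every step of ρ is ±1, and a change of sign would make ρ return to the value two steps earlier,
against injectivity. Hence ρ is a rotation or a reflection. -/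
lemma eq_add_mul_of_near_preserving {N k : ℕ} [NeZero N] (hk : 1 ≤ k) (hN : 2 * k + 3 ≤ N)
    (ρ : Equiv.Perm (Fin N)) (hρ : ∀ i j, Near k (j - i) ↔ Near k (ρ j - ρ i)) (m : ℕ) :
    ρ (m : Fin N) = ρ 0 + m * (ρ 1 - ρ 0) ∧ ρ ((m : Fin N) + 1) = ρ 0 + (m + 1) * (ρ 1 - ρ 0) := by
  have hstep := unit_step_of_near_preserving hk hN ρ hρ
  induction m with
  | zero => simp
  | succ m ih =>
    refine ⟨by push_cast; exact ih.2, ?_⟩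
    push_cast
    have h1 := hstep ((m : Fin N) + 1) ((m : Fin N) + 1 + 1) (by simp)
    have h0 := hstep 0 1 (by simp)
    have hne : ρ ((m : Fin N) + 1 + 1) ≠ ρ (m : Fin N) := by
      rw [Ne, ρ.injective.eq_iff, add_assoc, add_eq_left, one_add_one_eq_two, Fin.ext_iff]
      have : ((2 : Fin N).val) = 2 := by
        have : (2 : Fin N) = ((2 : ℕ) : Fin N) := by norm_num
        rw [this, Fin.val_natCast, Nat.mod_eq_of_lt (by omega)]
      rw [this]; simp
    have hε : ρ ((m : Fin N) + 1 + 1) - ρ ((m : Fin N) + 1) = ρ 1 - ρ 0 := by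
      by_contra hcon
      apply hne
      have hneg : ρ ((m : Fin N) + 1 + 1) - ρ ((m : Fin N) + 1) = -(ρ 1 - ρ 0) := by
        rcases h0 with h0 | h0 <;> rcases h1 with h1 | h1 <;> simp_all
      rw [ih.1, ← sub_add_cancel (ρ ((m : Fin N) + 1 + 1)) (ρ ((m : Fin N) + 1)), hneg, ih.2]
      ring
    rw [← sub_add_cancel (ρ ((m : Fin N) + 1 + 1)) (ρ ((m : Fin N) + 1)), hε, ih.2]
    ring

open Classical in
-- Relative to one member τ₀ of the fibre, τ₀⁻¹τ is dihedral, so its value at 0 and its first step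
-- determine it.
lemma card_fibre_le {N d : ℕ} (hd2 : Even d) (hd0 : 0 < d) (hd : d + 3 ≤ N)
    (S : Set (Fin N × Fin N)) :
    (Finset.univ.filter fun τ : Equiv.Perm (Fin N) => supportUnion d τ = S).card ≤ 2 * N := by
  have : NeZero N := ⟨by omega⟩
  obtain ⟨r, hr⟩ := hd2
  rcases (Finset.univ.filter fun τ : Equiv.Perm (Fin N) => supportUnion d τ = S).eq_empty_or_nonempty
    with h | ⟨τ₀, hτ₀⟩
  · rw [h]; simp
  rw [Finset.mem_filter] at hτ₀
  have hpres : ∀ τ : Equiv.Perm (Fin N), supportUnion d τ = S → ∀ i j,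
      Near (d / 2) (j - i) ↔ Near (d / 2) ((τ.trans τ₀.symm) j - (τ.trans τ₀.symm) i) :=
    fun τ hτ i j => supportUnion_eq_iff (by omega) (hτ.trans hτ₀.2.symm) i j
  let g : Equiv.Perm (Fin N) → Fin N × Fin N := fun τ =>
    ((τ.trans τ₀.symm) 0, (τ.trans τ₀.symm) 1 - (τ.trans τ₀.symm) 0)
  calc _ ≤ ((Finset.univ : Finset (Fin N)) ×ˢ ({1, -1} : Finset (Fin N))).card := by
        refine Finset.card_le_card_of_injOn g ?_ ?_
        · intro τ hτ
          simp only [Finset.coe_filter, Finset.mem_univ, true_and, Set.mem_ofPred_eq] at hτ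
          have := unit_step_of_near_preserving (by omega) (by omega) (τ.trans τ₀.symm) (hpres τ hτ)
            0 1 (by simp)
          simpa [g] using this
        · intro τ hτ τ' hτ' hg
          simp only [Finset.coe_filter, Finset.mem_univ, true_and, Set.mem_ofPred_eq] at hτ hτ'
          simp only [g, Prod.mk.injEq] at hg
          ext1 i
          have h1 := (eq_add_mul_of_near_preserving (by omega) (by omega) (τ.trans τ₀.symm)
            (hpres τ hτ) i.val).1
          have h2 := (eq_add_mul_of_near_preserving (by omega) (by omega) (τ'.trans τ₀.symm)
            (hpres τ' hτ') i.val).1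
          rw [hg.2, hg.1, ← h2] at h1
          simpa using h1
    _ ≤ _ := by
        rw [Finset.card_product, Finset.card_univ, Fintype.card_fin, mul_comm]
        exact Nat.mul_le_mul_right _ Finset.card_le_two

lemma not_near_iff {h : ℕ} [NeZero (2 * h)] (v : Fin (2 * h)) :
    ¬ Near (h - 1) v ↔ v = (h : Fin (2 * h)) := by
  have := NeZero.pos (2 * h)
  rw [Fin.ext_iff, Fin.val_natCast, Nat.mod_eq_of_lt (by omega), Near]
  omega

open Classical in
-- When N = 2h and d = N − 2, the only non-neighbour of a position is its antipode. So τ₀⁻¹τ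
-- commutes with i ↦ i + h and is determined by its values on the first h positions; counting all
-- injections there is wasteful but sufficient.
lemma card_fibre_mul_le {h : ℕ} (hh : 1 ≤ h) (S : Set (Fin (2 * h) × Fin (2 * h))) :
    (Finset.univ.filter fun τ : Equiv.Perm (Fin (2 * h)) =>
      supportUnion (2 * h - 2) τ = S).card * h ! ≤ (2 * h)! := by
  have : NeZero (2 * h) := ⟨by omega⟩
  rcases (Finset.univ.filter fun τ : Equiv.Perm (Fin (2 * h)) =>
    supportUnion (2 * h - 2) τ = S).eq_empty_or_nonempty with h | ⟨τ₀, hτ₀⟩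
  · rw [h]; simp
  rw [Finset.mem_filter] at hτ₀
  have hpres : ∀ τ : Equiv.Perm (Fin (2 * h)), supportUnion (2 * h - 2) τ = S → ∀ i,
      τ₀.symm (τ (i + h)) = τ₀.symm (τ i) + h := by
    intro τ hτ i
    have := (supportUnion_eq_iff (by omega) (hτ.trans hτ₀.2.symm) i (i + h)).not
    rw [show (2 * h - 2) / 2 = h - 1 by omega, not_near_iff, not_near_iff, add_sub_cancel_left,
      sub_eq_iff_eq_add'] at this
    exact this.1 rfl
  let g : Equiv.Perm (Fin (2 * h)) → (Fin h ↪ Fin (2 * h)) := fun τ =>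
    (Fin.castLEEmb (by omega : h ≤ 2 * h)).trans (τ.trans τ₀.symm).toEmbedding
  have hcard : (Finset.univ.filter fun τ : Equiv.Perm (Fin (2 * h)) =>
      supportUnion (2 * h - 2) τ = S).card ≤ (2 * h).descFactorial h := by
    calc _ ≤ (Finset.univ : Finset (Fin h ↪ Fin (2 * h))).card := by
          refine Finset.card_le_card_of_injOn g (fun _ _ => Finset.mem_coe.2 (Finset.mem_univ _)) ?_
          intro τ hτ τ' hτ' hg
          simp only [Finset.coe_filter, Finset.mem_univ, true_and, Set.mem_ofPred_eq] at hτ hτ'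
          have hlow : ∀ i : Fin (2 * h), i.val < h → τ₀.symm (τ i) = τ₀.symm (τ' i) :=
            fun i hi => DFunLike.congr_fun hg ⟨i.val, hi⟩
          ext1 i
          apply τ₀.symm.injective
          by_cases hi : i.val < h
          · exact hlow i hi
          · have hs : i = ⟨i.val - h, by omega⟩ + (h : Fin (2 * h)) := by
              ext
              rw [Fin.val_add, Fin.val_natCast, Nat.mod_eq_of_lt (a := h) (by omega),
                Nat.mod_eq_of_lt] <;> simp only <;> omega
            rw [hs, hpres τ hτ, hpres τ' hτ', hlow _ (by simp only; omega)]
      _ = _ := by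
          rw [Finset.card_univ, Fintype.card_embedding_eq, Fintype.card_fin, Fintype.card_fin]
  calc _ ≤ (2 * h).descFactorial h * h ! := Nat.mul_le_mul_right _ hcard
    _ = _ := by
        rw [← Nat.factorial_mul_descFactorial (by omega : h ≤ 2 * h), mul_comm,
          show 2 * h - h = h by omega]

end Fibre

/-! ### The matrices I + H ⊙ Q. -/

section Precision

variable {N d : ℕ}

lemma edgeSet_comm (π : Equiv.Perm (Fin N)) (a b : Fin N) :
    (a, b) ∈ edgeSet d π ↔ (b, a) ∈ edgeSet d π := by
  simp only [edgeSet, Set.mem_ofPred_eq, Prod.mk.injEq]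
  constructor <;>
  · rintro ⟨i, j, h1, h2, h | h⟩
    · exact ⟨i, j, h1, h2, Or.inr h.symm⟩
    · exact ⟨i, j, h1, h2, Or.inl h.symm⟩

lemma notMem_edgeSet_self (hd : d + 2 ≤ N) (π : Equiv.Perm (Fin N)) (a : Fin N) :
    (a, a) ∉ edgeSet d π := by
  have := mem_edgeSet_iff hd π (π.symm a) (π.symm a)
  simp only [Equiv.apply_symm_apply] at this
  simp [this]

open Classical in
lemma edgeMatrix_apply (π : Equiv.Perm (Fin N)) (a b : Fin N) :
    edgeMatrix d π a b = if (a, b) ∈ edgeSet d π then 1 else 0 := by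
  simp [edgeMatrix, Set.indicator_apply]

lemma edgeMatrix_nonneg (π : Equiv.Perm (Fin N)) (a b : Fin N) : 0 ≤ edgeMatrix d π a b := by
  rw [edgeMatrix_apply]; split_ifs <;> norm_num

lemma edgeMatrix_sq (π : Equiv.Perm (Fin N)) (a b : Fin N) :
    edgeMatrix d π a b ^ 2 = edgeMatrix d π a b := by
  rw [edgeMatrix_apply]; split_ifs <;> norm_num

lemma edgeMatrix_comm (π : Equiv.Perm (Fin N)) (a b : Fin N) :
    edgeMatrix d π a b = edgeMatrix d π b a := by
  rw [edgeMatrix_apply, edgeMatrix_apply, edgeSet_comm]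

lemma edgeMatrix_self (hd : d + 2 ≤ N) (π : Equiv.Perm (Fin N)) (a : Fin N) :
    edgeMatrix d π a a = 0 := by
  rw [edgeMatrix_apply, if_neg (notMem_edgeSet_self hd π a)]

lemma sum_edgeMatrix (hd2 : Even d) (hd : d + 2 ≤ N) (π : Equiv.Perm (Fin N)) (a : Fin N) :
    ∑ b, edgeMatrix d π a b = d := by
  classical
  simp_rw [edgeMatrix_apply]
  rw [Finset.sum_boole]
  norm_cast
  rw [← Set.ncard_coe_finset]
  simpa using ncard_neighbours hd2 hd π a

lemma precision_apply (π : Equiv.Perm (Fin N)) (q : Coupling N) (a b : Fin N) :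
    precision d π q a b = (1 : Matrix (Fin N) (Fin N) ℝ) a b + edgeMatrix d π a b * q a b := rfl

lemma dotProduct_precision_mulVec (π : Equiv.Perm (Fin N)) (q : Coupling N) (x : Fin N → ℝ) :
    x ⬝ᵥ precision d π q *ᵥ x =
      x ⬝ᵥ x + ∑ a, ∑ b, edgeMatrix d π a b * q a b * (x a * x b) := by
  rw [precision, Matrix.add_mulVec, dotProduct_add, Matrix.one_mulVec]
  congr 1
  simp only [dotProduct, Matrix.mulVec, Finset.mul_sum, Matrix.hadamard_apply, Matrix.of_apply]
  exact Finset.sum_congr rfl fun a _ => Finset.sum_congr rfl fun b _ => by ring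

/-- Diagonal dominance in quadratic-form version: each edge term is at least −(x_a² + x_b²)/(4d),
and every vertex has degree d, so the total loss is half of |x|². -/
lemma half_le_precision (hd2 : Even d) (hd0 : 0 < d) (hd : d + 2 ≤ N) (π : Equiv.Perm (Fin N))
    {q : Coupling N} (hq : q ∈ couplingBox N d) (x : Fin N → ℝ) :
    x ⬝ᵥ x / 2 ≤ x ⬝ᵥ precision d π q *ᵥ x := by
  have hd0' : (0 : ℝ) < d := by exact_mod_cast hd0
  rw [dotProduct_precision_mulVec]
  have hterm : ∀ a b, edgeMatrix d π a b * (-(1 / (4 * (d : ℝ))) * (x a ^ 2 + x b ^ 2)) ≤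
      edgeMatrix d π a b * q a b * (x a * x b) := by
    intro a b
    rw [mul_assoc]
    refine mul_le_mul_of_nonneg_left ?_ (edgeMatrix_nonneg π a b)
    have hqab : |q a b| ≤ 1 / (2 * (d : ℝ)) := abs_le.2 (hq.2 a b)
    have h1 : |x a * x b| ≤ (x a ^ 2 + x b ^ 2) / 2 :=
      abs_le.2 ⟨by nlinarith [sq_nonneg (x a + x b)], by nlinarith [sq_nonneg (x a - x b)]⟩
    have h2 : |q a b * (x a * x b)| ≤ 1 / (2 * (d : ℝ)) * ((x a ^ 2 + x b ^ 2) / 2) := by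
      rw [abs_mul]
      exact mul_le_mul hqab h1 (abs_nonneg _) (by positivity)
    have h3 := (abs_le.1 h2).1
    calc _ = -(1 / (2 * (d : ℝ)) * ((x a ^ 2 + x b ^ 2) / 2)) := by field_simp; ring
      _ ≤ _ := h3
  have hsum : ∑ a, ∑ b, edgeMatrix d π a b * (-(1 / (4 * (d : ℝ))) * (x a ^ 2 + x b ^ 2)) =
      -(x ⬝ᵥ x / 2) := by
    have e : ∀ a b, edgeMatrix d π a b * (-(1 / (4 * (d : ℝ))) * (x a ^ 2 + x b ^ 2)) =
        -(1 / (4 * (d : ℝ))) * (x a ^ 2 * edgeMatrix d π a b) +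
          -(1 / (4 * (d : ℝ))) * (x b ^ 2 * edgeMatrix d π a b) := fun a b => by ring
    simp_rw [e, Finset.sum_add_distrib, ← Finset.mul_sum, sum_edgeMatrix hd2 hd]
    rw [Finset.sum_comm (f := fun a b => x b ^ 2 * edgeMatrix d π a b)]
    have e2 : ∀ b, ∑ a, x b ^ 2 * edgeMatrix d π a b = x b ^ 2 * d := fun b => by
      rw [← Finset.mul_sum]
      simp_rw [edgeMatrix_comm π _ b, sum_edgeMatrix hd2 hd]
    simp_rw [e2, ← Finset.sum_mul, dotProduct, ← sq]
    field_simp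
    ring
  have := Finset.sum_le_sum fun a (_ : a ∈ Finset.univ) =>
    Finset.sum_le_sum fun b (_ : b ∈ Finset.univ) => hterm a b
  rw [hsum] at this
  linarith

lemma precision_posDef (hd2 : Even d) (hd0 : 0 < d) (hd : d + 2 ≤ N) (π : Equiv.Perm (Fin N))
    {q : Coupling N} (hq : q ∈ couplingBox N d) : (precision d π q).PosDef := by
  refine Matrix.PosDef.of_dotProduct_mulVec_pos ?_ fun x hx => ?_
  · ext a b
    simp only [Matrix.conjTranspose_apply, star_trivial, precision_apply]
    rw [edgeMatrix_comm, hq.1, Matrix.one_apply, Matrix.one_apply]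
    simp [eq_comm]
  · have h := half_le_precision hd2 hd0 hd π hq x
    have hpos : 0 < x ⬝ᵥ x := by
      have := Matrix.dotProduct_star_self_pos_iff.2 hx
      simpa using this
    simp only [star_trivial]
    linarith

lemma trace_precision (hd : d + 2 ≤ N) (π : Equiv.Perm (Fin N)) (q : Coupling N) :
    (precision d π q).trace = N := by
  simp [Matrix.trace, precision_apply, edgeMatrix_self hd]

lemma sum_sq_precision_sub_one_le (hd2 : Even d) (hd0 : 0 < d) (hd : d + 2 ≤ N)
    (π : Equiv.Perm (Fin N)) {q : Coupling N} (hq : q ∈ couplingBox N d) :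
    ∑ a, ∑ b, (precision d π q - 1) a b ^ 2 ≤ N / (4 * d) := by
  have hd0' : (0 : ℝ) < d := by exact_mod_cast hd0
  calc ∑ a, ∑ b, (precision d π q - 1) a b ^ 2
      ≤ ∑ a, ∑ b, edgeMatrix d π a b * (1 / (2 * (d : ℝ))) ^ 2 := by
        refine Finset.sum_le_sum fun a _ => Finset.sum_le_sum fun b _ => ?_
        rw [Matrix.sub_apply, precision_apply, add_sub_cancel_left, mul_pow, edgeMatrix_sq]
        refine mul_le_mul_of_nonneg_left ?_ (edgeMatrix_nonneg π a b)
        exact sq_le_sq' (hq.2 a b).1 (hq.2 a b).2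
    _ = N / (4 * d) := by
        simp_rw [← Finset.sum_mul, sum_edgeMatrix hd2 hd]
        simp
        field_simp
        norm_num

lemma matSupport_precision_subset (π : Equiv.Perm (Fin N)) (q : Coupling N) :
    matSupport (precision d π q) ⊆ supportUnion d π := by
  classical
  rintro ⟨a, b⟩ h
  simp only [matSupport, Set.mem_ofPred_eq, precision_apply, edgeMatrix_apply, Matrix.one_apply] at h
  by_contra hcon
  simp only [supportUnion, Set.mem_union, Set.mem_ofPred_eq, not_or] at hcon
  simp [hcon] at h

lemma matSupport_precision_eq (hd : d + 2 ≤ N) (π : Equiv.Perm (Fin N)) {q : Coupling N}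
    (hq : ∀ a b, a ≠ b → q a b ≠ 0) : matSupport (precision d π q) = supportUnion d π := by
  refine (matSupport_precision_subset π q).antisymm ?_
  rintro ⟨a, b⟩ h
  simp only [matSupport, Set.mem_ofPred_eq, precision_apply]
  by_cases hab : a = b
  · subst hab; simp [edgeMatrix_self hd]
  · have hE : (a, b) ∈ edgeSet d π := by
      simpa [supportUnion, hab] using h
    rw [Matrix.one_apply_ne hab, edgeMatrix_apply, if_pos hE]
    simpa using hq a b hab

end Precision

/-! ### Sub-Gaussianity and the conditional family given the permutation. -/

lemma isSubGaussianVector_multivariateGaussian {N : ℕ} {A : Matrix (Fin N) (Fin N) ℝ}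
    (hA : A.PosDef) {σ : ℝ≥0} (hσ : 1 ≤ σ) :
    IsSubGaussianVector (multivariateGaussian 0 A⁻¹) A σ where
  isProbabilityMeasure := inferInstance
  posDef := hA
  memLp := memLp_eval_multivariateGaussian A⁻¹
  mean := integral_eval_multivariateGaussian A⁻¹
  covariance := covariance_eval_multivariateGaussian hA.inv.posSemidef
  subGaussian i := by
    have hv : 0 < A⁻¹ i i := hA.inv.diag_pos
    have hmp := (measurePreserving_eval_multivariateGaussian (μ := 0) hA.inv.posSemidef
      (i := i)).map_eq
    have hmap : (multivariateGaussian 0 A⁻¹).map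
        (fun x : EuclideanSpace ℝ (Fin N) => x i / Real.sqrt (A⁻¹ i i)) = gaussianReal 0 1 := by
      have := gaussianReal_map_div_const (μ := (0 : EuclideanSpace ℝ (Fin N)) i)
        (v := (A⁻¹ i i).toNNReal) (Real.sqrt (A⁻¹ i i))
      rw [← hmp, Measure.map_map (by fun_prop) (by fun_prop)] at this
      convert this using 2
      · rfl
      · simp
      · ext
        simp [Real.sq_sqrt hv.le, hv.le, hv.ne']
    refine ⟨fun t => ?_, fun t => ?_⟩
    · have h := integrable_exp_mul_gaussianReal (μ := 0) (v := 1) t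
      rw [← hmap, integrable_map_measure (by fun_prop) (by fun_prop)] at h
      exact h
    · rw [mgf_gaussianReal hmap]
      apply Real.exp_le_exp.2
      have : (1 : ℝ) ≤ σ := by exact_mod_cast hσ
      have h2 : (1 : ℝ) ≤ (σ : ℝ) ^ 2 := by nlinarith
      push_cast
      nlinarith [sq_nonneg t, mul_le_mul_of_nonneg_right h2 (sq_nonneg t)]

section Family

variable {Ω : Type*} [MeasurableSpace Ω] {N K n d : ℕ} {P : Measure Ω}
  {π : Ω → Equiv.Perm (Fin N)} {Q : Ω → Fin K → Coupling N} {X : Ω → Data N K n}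

lemma IsExperiment.measurableSet_perm (h : IsExperiment d P π Q X) (τ : Equiv.Perm (Fin N)) :
    MeasurableSet {ω | π ω = τ} :=
  h.measurable_perm (MeasurableSpace.measurableSet_top (s := {τ}))

lemma IsExperiment.measure_perm_ne_zero (h : IsExperiment d P π Q X) (τ : Equiv.Perm (Fin N)) :
    P {ω | π ω = τ} ≠ 0 := by
  rw [h.uniform]; simp

lemma IsExperiment.measure_perm_inter (h : IsExperiment d P π Q X) (τ : Equiv.Perm (Fin N))
    {B : Set (Fin K → Coupling N)} (hB : MeasurableSet B) :
    P ({ω | π ω = τ} ∩ Q ⁻¹' B) = ((N ! : ℕ) : ℝ≥0∞)⁻¹ * P (Q ⁻¹' B) := by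
  rw [← h.uniform τ]
  exact h.indep.measure_inter_preimage_eq_mul _ _ (MeasurableSpace.measurableSet_top (s := {τ})) hB

/-- Independence of Q and π: conditioning on the permutation leaves the joint law of Q unchanged, so
independence and equality of laws across tasks survive. -/
lemma IsExperiment.map_cond [IsProbabilityMeasure P] (h : IsExperiment d P π Q X) (τ : Equiv.Perm (Fin N)) :
    (cond P {ω | π ω = τ}).map Q = P.map Q := by
  ext B hB
  rw [Measure.map_apply h.measurable_coupling hB, Measure.map_apply h.measurable_coupling hB,
    cond_apply (h.measurableSet_perm τ), h.measure_perm_inter τ hB, ← h.uniform τ,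
    ENNReal.inv_mul_cancel_left (h.measure_perm_ne_zero τ) (measure_ne_top _ _)]

lemma IsExperiment.map_cond_apply [IsProbabilityMeasure P] (h : IsExperiment d P π Q X)
    (τ : Equiv.Perm (Fin N)) (k : Fin K) : (cond P {ω | π ω = τ}).map (fun ω => Q ω k) = P.map (fun ω => Q ω k) := by
  have := congrArg (Measure.map fun q : Fin K → Coupling N => q k) (h.map_cond τ)
  rwa [Measure.map_map (measurable_pi_apply k) h.measurable_coupling,
    Measure.map_map (measurable_pi_apply k) h.measurable_coupling] at this

lemma precision_add_hadamard (τ : Equiv.Perm (Fin N)) (q₀ q : Coupling N) :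
    precision d τ q₀ + Matrix.of (fun a b => (edgeMatrix d τ ⊙ Matrix.of (q - q₀)) a b) =
      precision d τ q := by
  ext a b
  simp [precision_apply, Matrix.hadamard_apply]
  ring

lemma continuous_precision (τ : Equiv.Perm (Fin N)) :
    Continuous fun q : Coupling N => precision d τ q := by
  refine continuous_matrix fun a b => ?_
  simp only [precision_apply]
  fun_prop

lemma measurable_precision_inv_apply (τ : Equiv.Perm (Fin N)) (i j : Fin N) :
    Measurable fun q : Coupling N => (precision d τ q)⁻¹ i j := by
  simp only [Matrix.inv_def, Matrix.smul_apply, Ring.inverse_eq_inv', smul_eq_mul]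
  have hc := continuous_precision (d := d) τ
  exact hc.matrix_det.measurable.inv.mul
    ((continuous_apply_apply i j).comp hc.matrix_adjugate).measurable

lemma IsExperiment.isRandomSubGaussianFamily [IsProbabilityMeasure P]
    (h : IsExperiment d P π Q X) (hd2 : Even d)
    (hd0 : 0 < d) (hd : d + 2 ≤ N) {q₀ : Coupling N} (hq₀ : q₀ ∈ couplingBox N d)
    (hne : ∀ a b, a ≠ b → q₀ a b ≠ 0) (hindep : iIndepFun (fun k ω => Q ω k) P)
    (hid : ∀ k l, IdentDistrib (fun ω => Q ω k) (fun ω => Q ω l) P P)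
    (τ : Equiv.Perm (Fin N)) {c : ℝ} (hc : 0 < c)
    (hspec : ∀ r ∈ spectrum ℝ (precision d τ q₀), c ≤ r / 2)
    (hnorm : ∀ᵐ ω ∂P, ∀ k, ‖Matrix.toEuclideanCLM (𝕜 := ℝ)
      (edgeMatrix d τ ⊙ Matrix.of (Q ω k - q₀))‖ ≤ c) {σ : ℝ≥0} (hσ : 1 ≤ σ) :
    IsRandomSubGaussianFamily (cond P {ω | π ω = τ}) (precision d τ q₀)
      (fun ω k a b => (edgeMatrix d τ ⊙ Matrix.of (Q ω k - q₀)) a b) X σ := by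
  have hac : cond P {ω | π ω = τ} ≪ P := cond_absolutelyContinuous
  have : IsProbabilityMeasure (cond P {ω | π ω = τ}) :=
    cond_isProbabilityMeasure (h.measure_perm_ne_zero τ)
  have hbox := hac.ae_le h.mem_box
  have hQk : ∀ k, Measurable fun ω => Q ω k := fun k =>
    (measurable_pi_apply k).comp h.measurable_coupling
  have hg : Measurable fun (q : Coupling N) (a b : Fin N) =>
      (edgeMatrix d τ ⊙ Matrix.of (q - q₀)) a b := by
    refine measurable_pi_lambda _ fun a => measurable_pi_lambda _ fun b => ?_
    simp only [Matrix.hadamard_apply, Matrix.of_apply, Pi.sub_apply]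
    fun_prop
  have hG : Measurable fun (q : Fin K → Coupling N) (k : Fin K) (a b : Fin N) =>
      (edgeMatrix d τ ⊙ Matrix.of (q k - q₀)) a b :=
    measurable_pi_lambda _ fun k => hg.comp (measurable_pi_apply k)
  have hentry : ∀ᵐ ω ∂cond P {ω | π ω = τ}, ∀ k i j, |(precision d τ (Q ω k))⁻¹ i j| ≤ 2 := by
    filter_upwards [hbox] with ω hω k
    exact abs_inv_apply_le (precision_posDef hd2 hd0 hd τ (hω k))
      (half_le_precision hd2 hd0 hd τ (hω k))
  -- The entry bound γ = 2 comes from |A⁻¹e_j|² ≤ 4, a consequence of A ≥ 1/2; the given `c` itself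
  -- serves as the norm bound.
  refine ⟨precision_posDef hd2 hd0 hd τ hq₀, hG.comp h.measurable_coupling, h.measurable_data,
    ?_, ?_, ⟨2, c, two_pos, hc, hspec, ?_⟩, ?_, ?_⟩
  · refine iIndepFun.comp (f := fun k ω => Q ω k) ?_ (fun _ => _) fun _ => hg
    rw [iIndepFun_iff_map_fun_eq_pi_map fun k => (hQk k).aemeasurable] at hindep ⊢
    simp_rw [h.map_cond_apply τ]
    rw [← hindep]
    exact h.map_cond τ
  · intro k l
    suffices hs : IdentDistrib (fun ω => Q ω k) (fun ω => Q ω l) (cond P {ω | π ω = τ})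
        (cond P {ω | π ω = τ}) from hs.comp hg
    refine ⟨(hQk k).aemeasurable, (hQk l).aemeasurable, ?_⟩
    rw [h.map_cond_apply, h.map_cond_apply]
    exact (hid k l).map_eq
  · filter_upwards [hbox, hac.ae_le hnorm, hentry] with ω h1 h2 h3 k
    rw [precision_add_hadamard]
    refine ⟨precision_posDef hd2 hd0 hd τ (h1 k), ?_, h3 k, h2 k⟩
    rw [matSupport_precision_eq hd τ hne]
    rintro ⟨a, b⟩ hab
    left
    by_contra hE
    apply hab
    simp [Matrix.hadamard_apply, edgeMatrix_apply, hE]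
  · intro k i j
    simp_rw [precision_add_hadamard]
    refine Integrable.of_bound
      ((measurable_precision_inv_apply τ i j).comp (hQk k)).aestronglyMeasurable 2 ?_
    filter_upwards [hentry] with ω hω
    exact hω k i j
  · refine ⟨fun _ A => multivariateGaussian 0 A⁻¹, ?_, fun B C hB hC => ?_⟩
    · filter_upwards [hbox] with ω hω k
      rw [precision_add_hadamard]
      exact isSubGaussianVector_multivariateGaussian (precision_posDef hd2 hd0 hd τ (hω k)) hσ
    · simp_rw [precision_add_hadamard]
      have hB' := hG hB
      have hpre : (fun ω k a b => (edgeMatrix d τ ⊙ Matrix.of (Q ω k - q₀)) a b) ⁻¹' B =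
        Q ⁻¹' ((fun (q : Fin K → Coupling N) (k : Fin K) (a b : Fin N) =>
          (edgeMatrix d τ ⊙ Matrix.of (q k - q₀)) a b) ⁻¹' B) := rfl
      rw [hpre, cond_apply (h.measurableSet_perm τ), ← Set.inter_assoc, h.samples τ _ C hB' hC,
        ProbabilityTheory.cond, Measure.restrict_smul, lintegral_smul_measure, Measure.restrict_restrict
        (h.measurable_coupling hB'), Set.inter_comm, smul_eq_mul]
      rfl

end Family

/-! ### The law of the data for fixed permutation and couplings. -/

section DataLaw

variable {N K n d : ℕ}

/-- The law of `K` tasks of `n` independent standard Gaussian observations. -/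
noncomputable def stdData (N K n : ℕ) : Measure (Data N K n) :=
  Measure.pi fun _ => Measure.pi fun _ => stdGaussian (EuclideanSpace ℝ (Fin N))

instance : IsProbabilityMeasure (stdData N K n) := by
  unfold stdData; infer_instance

/-- The law of the data given the permutation and the coupling matrices. -/
noncomputable def dataLaw (n d : ℕ) (τ : Equiv.Perm (Fin N)) (q : Fin K → Coupling N) :
    Measure (Data N K n) :=
  Measure.pi fun k => Measure.pi fun _ : Fin n => gaussianLaw d τ (q k)

instance (τ : Equiv.Perm (Fin N)) (q : Fin K → Coupling N) :
    IsProbabilityMeasure (dataLaw n d τ q) := by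
  unfold dataLaw gaussianLaw; infer_instance

/-- The density of `dataLaw` with respect to `stdData`. -/
noncomputable def dataDensity (d : ℕ) (τ : Equiv.Perm (Fin N)) (q : Fin K → Coupling N)
    (x : Data N K n) : ℝ :=
  ∏ k, ∏ t, gaussianDensity (precision d τ (q k)) (x k t)

lemma continuous_dataDensity (τ : Equiv.Perm (Fin N)) :
    Continuous fun p : (Fin K → Coupling N) × Data N K n => dataDensity d τ p.1 p.2 := by
  unfold dataDensity gaussianDensity
  have hp : ∀ k, Continuous fun p : (Fin K → Coupling N) × Data N K n => precision d τ (p.1 k) :=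
    fun k => (continuous_precision τ).comp (by fun_prop)
  have hx : ∀ k t, Continuous fun p : (Fin K → Coupling N) × Data N K n => (p.2 k t).ofLp := by
    intro k t; fun_prop
  refine continuous_finsetProd _ fun k _ => continuous_finsetProd _ fun t _ => ?_
  refine (hp k).matrix_det.sqrt.mul (Real.continuous_exp.comp (Continuous.div_const
    (Continuous.neg ?_) _))
  exact (hx k t).dotProduct (((hp k).sub continuous_const).matrix_mulVec (hx k t))

lemma dataDensity_pos (hd2 : Even d) (hd0 : 0 < d) (hd : d + 2 ≤ N) (τ : Equiv.Perm (Fin N))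
    {q : Fin K → Coupling N} (hq : ∀ k, q k ∈ couplingBox N d) (x : Data N K n) :
    0 < dataDensity d τ q x :=
  Finset.prod_pos fun k _ => Finset.prod_pos fun _ _ =>
    gaussianDensity_pos (precision_posDef hd2 hd0 hd τ (hq k)) _

lemma measurable_gaussianDensity (A : Matrix (Fin N) (Fin N) ℝ) : Measurable (gaussianDensity A) := by
  unfold gaussianDensity dotProduct Matrix.mulVec dotProduct
  fun_prop

lemma measurable_dataDensity (τ : Equiv.Perm (Fin N)) (q : Fin K → Coupling N) :
    Measurable fun x : Data N K n => dataDensity d τ q x :=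
  Finset.measurable_prod _ fun k _ => Finset.measurable_prod _ fun t _ =>
    (measurable_gaussianDensity _).comp ((measurable_pi_apply t).comp (measurable_pi_apply k))

lemma measurable_dataDensity_prod (τ : Equiv.Perm (Fin N)) :
    Measurable fun p : (Fin K → Coupling N) × Data N K n => dataDensity d τ p.1 p.2 :=
  (continuous_dataDensity τ).measurable

lemma dataLaw_eq_withDensity (hd2 : Even d) (hd0 : 0 < d) (hd : d + 2 ≤ N)
    (τ : Equiv.Perm (Fin N)) {q : Fin K → Coupling N} (hq : ∀ k, q k ∈ couplingBox N d) :
    dataLaw n d τ q =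
      (stdData N K n).withDensity fun x => ENNReal.ofReal (dataDensity d τ q x) := by
  have hpd : ∀ k, (precision d τ (q k)).PosDef := fun k => precision_posDef hd2 hd0 hd τ (hq k)
  have hm : ∀ k, Measurable fun x : EuclideanSpace ℝ (Fin N) =>
      ENNReal.ofReal (gaussianDensity (precision d τ (q k)) x) :=
    fun k => (measurable_gaussianDensity _).ennreal_ofReal
  have hg : ∀ k, gaussianLaw d τ (q k) = (stdGaussian (EuclideanSpace ℝ (Fin N))).withDensity
      fun x => ENNReal.ofReal (gaussianDensity (precision d τ (q k)) x) :=
    fun k => multivariateGaussian_inv_eq_withDensity (hpd k)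
  have hgp : ∀ k, IsProbabilityMeasure (gaussianLaw d τ (q k)) := fun k => by
    unfold gaussianLaw; infer_instance
  have hinner : ∀ k, (Measure.pi fun _ : Fin n => gaussianLaw d τ (q k)) =
      (Measure.pi fun _ : Fin n => stdGaussian (EuclideanSpace ℝ (Fin N))).withDensity
        fun x => ∏ t, ENNReal.ofReal (gaussianDensity (precision d τ (q k)) (x t)) := by
    intro k
    have := hgp k
    rw [hg k] at this ⊢
    exact pi_withDensity _ _ fun _ => hm k
  have hprob : ∀ k, IsProbabilityMeasure
      ((Measure.pi fun _ : Fin n => stdGaussian (EuclideanSpace ℝ (Fin N))).withDensity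
        fun x => ∏ t, ENNReal.ofReal (gaussianDensity (precision d τ (q k)) (x t))) := by
    intro k; rw [← hinner k]; infer_instance
  unfold dataLaw stdData
  simp_rw [hinner]
  have hmk : ∀ k, Measurable fun x : Fin n → EuclideanSpace ℝ (Fin N) =>
      ∏ t, ENNReal.ofReal (gaussianDensity (precision d τ (q k)) (x t)) :=
    fun k => Finset.measurable_prod _ fun t _ => (hm k).comp (measurable_pi_apply t)
  rw [pi_withDensity _ _ hmk]
  congr 1
  ext x
  have hnn : ∀ k t, 0 ≤ gaussianDensity (precision d τ (q k)) (x k t) :=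
    fun k t => (gaussianDensity_pos (hpd k) _).le
  rw [dataDensity, ENNReal.ofReal_prod_of_nonneg fun k _ => Finset.prod_nonneg fun t _ => hnn k t]
  exact Finset.prod_congr rfl fun k _ =>
    (ENNReal.ofReal_prod_of_nonneg fun t _ => hnn k t).symm

/-- Relative entropy adds over the nK independent samples, each contributing at most N/(4d). -/
lemma integral_log_dataDensity_le (hd2 : Even d) (hd0 : 0 < d) (hd : d + 2 ≤ N)
    (τ : Equiv.Perm (Fin N)) {q : Fin K → Coupling N} (hq : ∀ k, q k ∈ couplingBox N d) :
    Integrable (fun x => Real.log (dataDensity d τ q x)) (dataLaw n d τ q) ∧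
    ∫ x, Real.log (dataDensity d τ q x) ∂dataLaw n d τ q ≤ (n * K : ℝ) * (N / (4 * d)) := by
  have hpd : ∀ k, (precision d τ (q k)).PosDef := fun k => precision_posDef hd2 hd0 hd τ (hq k)
  have hgp : ∀ k, IsProbabilityMeasure (gaussianLaw d τ (q k)) := fun k => by
    unfold gaussianLaw; infer_instance
  have hlog : ∀ x : Data N K n, Real.log (dataDensity d τ q x) =
      ∑ k, ∑ t, Real.log (gaussianDensity (precision d τ (q k)) (x k t)) := by
    intro x
    rw [dataDensity, Real.log_prod fun k _ =>
      (Finset.prod_pos fun t _ => gaussianDensity_pos (hpd k) _).ne']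
    exact Finset.sum_congr rfl fun k _ =>
      Real.log_prod fun t _ => (gaussianDensity_pos (hpd k) _).ne'
  have hint0 : ∀ k, Integrable (fun x => Real.log (gaussianDensity (precision d τ (q k)) x))
      (gaussianLaw d τ (q k)) := fun k => integrable_log_gaussianDensity (hpd k)
  have hint1 : ∀ k t, Integrable (fun y : Fin n → EuclideanSpace ℝ (Fin N) =>
      Real.log (gaussianDensity (precision d τ (q k)) (y t)))
      (Measure.pi fun _ : Fin n => gaussianLaw d τ (q k)) :=
    fun k t => integrable_comp_eval (μ := fun _ : Fin n => gaussianLaw d τ (q k)) (i := t) (hint0 k)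
  have hint : ∀ k t, Integrable (fun x : Data N K n =>
      Real.log (gaussianDensity (precision d τ (q k)) (x k t))) (dataLaw n d τ q) :=
    fun k t => integrable_comp_eval
      (μ := fun k => Measure.pi fun _ : Fin n => gaussianLaw d τ (q k)) (i := k) (hint1 k t)
  simp_rw [hlog]
  refine ⟨integrable_finsetSum _ fun k _ => integrable_finsetSum _ fun t _ => hint k t, ?_⟩
  rw [integral_finsetSum _ fun k _ => integrable_finsetSum _ fun t _ => hint k t]
  calc _ = ∑ k, ∑ _t : Fin n, ∫ x, Real.log (gaussianDensity (precision d τ (q k)) x)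
        ∂gaussianLaw d τ (q k) := by
        refine Finset.sum_congr rfl fun k _ => ?_
        rw [integral_finsetSum _ fun t _ => hint k t]
        refine Finset.sum_congr rfl fun t _ => ?_
        rw [← integral_comp_eval (μ := fun _ : Fin n => gaussianLaw d τ (q k)) (i := t)
          (hint0 k).aestronglyMeasurable]
        exact integral_comp_eval (μ := fun k => Measure.pi fun _ : Fin n => gaussianLaw d τ (q k))
          (i := k) (hint1 k t).aestronglyMeasurable
    _ ≤ ∑ _k : Fin K, ∑ _t : Fin n, (N / (4 * d) : ℝ) :=
        Finset.sum_le_sum fun k _ => Finset.sum_le_sum fun t _ =>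
          (integral_log_gaussianDensity_le (hpd k) (half_le_precision hd2 hd0 hd τ (hq k))
            (trace_precision hd τ _)).trans (sum_sq_precision_sub_one_le hd2 hd0 hd τ (hq k))
    _ = _ := by simp; ring

open Classical in
-- Under the reference law the data carry no information on τ: pointwise, the number of permutations
-- for which `s x` is correct is the size of one fibre.
lemma sum_stdData_le {M : ℝ} (hM : 0 < M)
    (hcard : ∀ S : Set (Fin N × Fin N), ((Finset.univ.filter fun τ : Equiv.Perm (Fin N) =>
      supportUnion d τ = S).card : ℝ) * M ≤ N !)
    {s : Data N K n → Set (Fin N × Fin N)} (hs : Measurable s) :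
    ∑ τ : Equiv.Perm (Fin N), (stdData N K n).real {x | s x = supportUnion d τ} ≤ N ! / M := by
  have hms : ∀ τ : Equiv.Perm (Fin N), MeasurableSet {x | s x = supportUnion d τ} :=
    fun τ => hs (measurableSet_singleton _)
  have h1 : ∀ τ : Equiv.Perm (Fin N), (stdData N K n).real {x | s x = supportUnion d τ} =
      ∫ x, {x | s x = supportUnion d τ}.indicator (fun _ => (1 : ℝ)) x ∂stdData N K n := by
    intro τ; rw [integral_indicator_const _ (hms τ)]; simp
  have hi : ∀ τ : Equiv.Perm (Fin N), Integrable
      ({x | s x = supportUnion d τ}.indicator fun _ => (1 : ℝ)) (stdData N K n) :=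
    fun τ => (integrable_const _).indicator (hms τ)
  have hle : ∀ x, ∑ τ : Equiv.Perm (Fin N),
      {x | s x = supportUnion d τ}.indicator (fun _ => (1 : ℝ)) x ≤ N ! / M := by
    intro x
    have hsum : ∑ τ : Equiv.Perm (Fin N),
        {x | s x = supportUnion d τ}.indicator (fun _ => (1 : ℝ)) x =
        ((Finset.univ.filter fun τ : Equiv.Perm (Fin N) => supportUnion d τ = s x).card : ℝ) := by
      rw [← Finset.sum_boole]
      refine Finset.sum_congr rfl fun τ _ => ?_
      rw [Set.indicator_apply]
      exact if_congr eq_comm rfl rfl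
    rw [hsum, le_div_iff₀ hM]
    exact hcard (s x)
  simp_rw [h1]
  rw [← integral_finsetSum _ fun τ _ => hi τ]
  calc _ ≤ ∫ _x, (N ! / M : ℝ) ∂stdData N K n :=
        integral_mono (integrable_finsetSum _ fun τ _ => hi τ) (integrable_const _) hle
    _ = _ := by simp

open Classical in
/-- The total success probability over all permutations, for fixed coupling matrices. -/
lemma mul_sum_dataLaw_le (hd2 : Even d) (hd0 : 0 < d) (hd : d + 2 ≤ N) {M : ℝ} (hM : 0 < M)
    (hcard : ∀ S : Set (Fin N × Fin N), ((Finset.univ.filter fun τ : Equiv.Perm (Fin N) =>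
      supportUnion d τ = S).card : ℝ) * M ≤ N !)
    {q : Fin K → Coupling N} (hq : ∀ k, q k ∈ couplingBox N d)
    {s : Data N K n → Set (Fin N × Fin N)} (hs : Measurable s) {t : ℝ} (ht : 0 ≤ t) (L : ℝ) :
    t * ∑ τ, (dataLaw n d τ q).real {x | s x = supportUnion d τ} ≤
      N ! * ((n * K : ℝ) * (N / (4 * d)) + (1 + (Real.exp t - 1) / M) / Real.exp L - 1 + L) := by
  have hms : ∀ τ : Equiv.Perm (Fin N), MeasurableSet {x | s x = supportUnion d τ} :=
    fun τ => hs (measurableSet_singleton _)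
  have hexp : 0 ≤ Real.exp t - 1 := by linarith [Real.add_one_le_exp t]
  have hν := sum_stdData_le hM hcard hs
  set v : Equiv.Perm (Fin N) → ℝ := fun τ => (stdData N K n).real {x | s x = supportUnion d τ}
  set w : Equiv.Perm (Fin N) → ℝ := fun τ => (dataLaw n d τ q).real {x | s x = supportUnion d τ}
  have hw : ∀ τ, t * w τ ≤ ((n * K : ℝ) * (N / (4 * d)) - 1 + L) +
      (1 + (Real.exp t - 1) * v τ) / Real.exp L := by
    intro τ
    obtain ⟨hi, hle⟩ := integral_log_dataDensity_le (n := n) hd2 hd0 hd τ hq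
    have hmeas : Measurable fun x : Data N K n => dataDensity d τ q x :=
      measurable_dataDensity τ q
    have := mul_measureReal_le_of_withDensity hmeas (dataDensity_pos hd2 hd0 hd τ hq)
      (dataLaw_eq_withDensity hd2 hd0 hd τ hq) hi (hms τ) t L
    linarith
  clear_value v w
  have hcardP : ((Finset.univ : Finset (Equiv.Perm (Fin N))).card : ℝ) = N ! := by
    rw [Finset.card_univ, Fintype.card_perm, Fintype.card_fin]
  generalize ((N ! : ℕ) : ℝ) = F at *
  calc t * ∑ τ, w τ = ∑ τ, t * w τ := Finset.mul_sum _ _ _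
    _ ≤ ∑ τ, (((n * K : ℝ) * (N / (4 * d)) - 1 + L) +
      (1 + (Real.exp t - 1) * v τ) / Real.exp L) := Finset.sum_le_sum fun τ _ => hw τ
    _ = F * ((n * K : ℝ) * (N / (4 * d)) - 1 + L) + (F + (Real.exp t - 1) * ∑ τ, v τ) /
            Real.exp L := by
        simp only [Finset.sum_add_distrib, ← Finset.sum_div, ← Finset.mul_sum, Finset.sum_const,
          nsmul_eq_mul, hcardP, mul_one]
        ring
    _ ≤ F * ((n * K : ℝ) * (N / (4 * d)) - 1 + L) + (F + (Real.exp t - 1) * (F / M)) /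
            Real.exp L := by gcongr
    _ = F * ((n * K : ℝ) * (N / (4 * d)) + (1 + (Real.exp t - 1) / M) / Real.exp L - 1 + L) := by
        ring

end DataLaw

/-! ### From fixed couplings to the random experiment. -/

section Transfer

variable {Ω 𝓤 : Type*} [MeasurableSpace Ω] [MeasurableSpace 𝓤] {N K n d : ℕ} {P : Measure Ω}
  [IsProbabilityMeasure P] {π : Ω → Equiv.Perm (Fin N)} {Q : Ω → Fin K → Coupling N}
  {X : Ω → Data N K n} {U : Ω → 𝓤} {S' : Ω → Set (Fin N × Fin N)}

/-- A single jointly measurable density over the product of the law of Q and the reference law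
replaces the conditional laws, which makes Fubini applicable. -/
lemma IsExperiment.map_restrict (h : IsExperiment d P π Q X) (hd2 : Even d) (hd0 : 0 < d)
    (hd : d + 2 ≤ N) (τ : Equiv.Perm (Fin N)) :
    (P.restrict {ω | π ω = τ}).map (fun ω => (Q ω, X ω)) =
      ((N ! : ℕ) : ℝ≥0∞)⁻¹ • ((P.map Q).prod (stdData N K n)).withDensity
        fun p => ENNReal.ofReal (dataDensity d τ p.1 p.2) := by
  have hQX : Measurable fun ω => (Q ω, X ω) := h.measurable_coupling.prodMk h.measurable_data
  have hdens : Measurable fun p : (Fin K → Coupling N) × Data N K n =>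
      ENNReal.ofReal (dataDensity d τ p.1 p.2) := (measurable_dataDensity_prod τ).ennreal_ofReal
  have := Measure.isProbabilityMeasure_map (μ := P) h.measurable_coupling.aemeasurable
  refine Measure.ext_prod fun {B C} hB hC => ?_
  have hg : Measurable fun q => ∫⁻ x in C, ENNReal.ofReal (dataDensity d τ q x) ∂stdData N K n :=
    hdens.lintegral_prod_right'
  have hmap : (P.restrict ({ω | π ω = τ} ∩ Q ⁻¹' B)).map Q =
      ((N ! : ℕ) : ℝ≥0∞)⁻¹ • (P.map Q).restrict B := by
    ext D hD
    rw [Measure.map_apply h.measurable_coupling hD, Measure.smul_apply, Measure.restrict_apply hD,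
      Measure.restrict_apply (h.measurable_coupling hD),
      Measure.map_apply h.measurable_coupling (hD.inter hB), Set.inter_left_comm,
      ← Set.preimage_inter, h.measure_perm_inter τ (hD.inter hB), smul_eq_mul]
  rw [Measure.map_apply hQX (hB.prod hC), Measure.restrict_apply (hQX (hB.prod hC)),
    Measure.smul_apply, withDensity_apply _ (hB.prod hC), ← Measure.prod_restrict,
    lintegral_prod _ hdens.aemeasurable, smul_eq_mul, ← smul_eq_mul, ← lintegral_smul_measure,
    ← hmap, lintegral_map hg h.measurable_coupling]
  have hset : (fun ω => (Q ω, X ω)) ⁻¹' B ×ˢ C ∩ {ω | π ω = τ} =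
      {ω | π ω = τ} ∩ Q ⁻¹' B ∩ X ⁻¹' C := by
    ext ω; simp only [Set.mem_inter_iff, Set.mem_preimage, Set.mem_prod]; tauto
  rw [hset, h.samples τ B C hB hC]
  refine lintegral_congr_ae (ae_restrict_of_ae ?_)
  filter_upwards [h.mem_box] with ω hω
  change dataLaw n d τ (Q ω) C = _
  rw [dataLaw_eq_withDensity hd2 hd0 hd τ hω, withDensity_apply _ hC]

/-- An upper bound on the success probability, uniform over couplings and estimators, bounds the
success probability of every estimate. -/
lemma IsEstimate.measure_success_le (h : IsExperiment d P π Q X) (hd2 : Even d) (hd0 : 0 < d)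
    (hd : d + 2 ≤ N) (hS : IsEstimate P π Q X U S') (r : ℝ≥0∞)
    (hr : ∀ q : Fin K → Coupling N, (∀ k, q k ∈ couplingBox N d) →
      ∀ s : Data N K n → Set (Fin N × Fin N), Measurable s →
        ∑ τ, dataLaw n d τ q {x | s x = supportUnion d τ} ≤ (N ! : ℕ) * r) :
    P {ω | S' ω = supportUnion d (π ω)} ≤ r := by
  obtain ⟨s, hs, hS's⟩ := hS.factors
  have hY : Measurable fun ω => (π ω, Q ω, X ω) :=
    h.measurable_perm.prodMk (h.measurable_coupling.prodMk h.measurable_data)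
  have hQX : Measurable fun ω => (Q ω, X ω) := h.measurable_coupling.prodMk h.measurable_data
  have hsτ : ∀ (u : 𝓤) (τ : Equiv.Perm (Fin N)), MeasurableSet
      {p : (Fin K → Coupling N) × Data N K n | s (p.2, p.1, u) = supportUnion d τ} := by
    intro u τ
    have : Measurable fun p : (Fin K → Coupling N) × Data N K n => s (p.2, p.1, u) :=
      hs.comp (by fun_prop)
    exact this (measurableSet_singleton _)
  have hslice : ∀ u, P {ω | s (X ω, Q ω, u) = supportUnion d (π ω)} ≤ r := by
    intro u
    have hun : {ω | s (X ω, Q ω, u) = supportUnion d (π ω)} = ⋃ τ ∈ (Finset.univ :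
        Finset (Equiv.Perm (Fin N))), {ω | s (X ω, Q ω, u) = supportUnion d τ} ∩ {ω | π ω = τ} := by
      ext ω; simp
    let G : Equiv.Perm (Fin N) → (Fin K → Coupling N) × Data N K n → ℝ≥0∞ := fun τ =>
      {p | s (p.2, p.1, u) = supportUnion d τ}.indicator
        fun p => ENNReal.ofReal (dataDensity d τ p.1 p.2)
    have hG : ∀ τ, Measurable (G τ) := fun τ =>
      (measurable_dataDensity_prod τ).ennreal_ofReal.indicator (hsτ u τ)
    have hGi : ∀ τ, Measurable fun q => ∫⁻ x, G τ (q, x) ∂stdData N K n :=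
      fun τ => (hG τ).lintegral_prod_right'
    have := Measure.isProbabilityMeasure_map (μ := P) h.measurable_coupling.aemeasurable
    have hle : ∀ᵐ ω ∂P, ∑ τ, ∫⁻ x, G τ (Q ω, x) ∂stdData N K n ≤ (N ! : ℕ) * r := by
      filter_upwards [h.mem_box] with ω hω
      have hsu : Measurable fun x => s (x, Q ω, u) := hs.comp (by fun_prop)
      refine le_trans (le_of_eq (Finset.sum_congr rfl fun τ _ => ?_)) (hr (Q ω) hω _ hsu)
      have hm : MeasurableSet {x | s (x, Q ω, u) = supportUnion d τ} :=
        hsu (measurableSet_singleton _)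
      rw [dataLaw_eq_withDensity hd2 hd0 hd τ hω, withDensity_apply _ hm, ← lintegral_indicator hm]
      rfl
    calc _ ≤ ∑ τ, P ({ω | s (X ω, Q ω, u) = supportUnion d τ} ∩ {ω | π ω = τ}) := by
          rw [hun]; exact measure_biUnion_finset_le _ _
      _ = ∑ τ, ((N ! : ℕ) : ℝ≥0∞)⁻¹ * ∫⁻ ω, ∫⁻ x, G τ (Q ω, x) ∂stdData N K n ∂P := by
          refine Finset.sum_congr rfl fun τ _ => ?_
          have h1 := DFunLike.congr_fun (h.map_restrict hd2 hd0 hd τ)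
            {p | s (p.2, p.1, u) = supportUnion d τ}
          rw [Measure.map_apply hQX (hsτ u τ), Measure.restrict_apply (hQX (hsτ u τ))] at h1
          refine h1.trans ?_
          rw [Measure.smul_apply, withDensity_apply _ (hsτ u τ), ← lintegral_indicator (hsτ u τ),
            lintegral_prod _ (hG τ).aemeasurable, lintegral_map (hGi τ) h.measurable_coupling,
            smul_eq_mul]
      _ = ((N ! : ℕ) : ℝ≥0∞)⁻¹ * ∫⁻ ω, ∑ τ, ∫⁻ x, G τ (Q ω, x) ∂stdData N K n ∂P := by
          rw [← Finset.mul_sum]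
          congr 1
          exact (lintegral_finsetSum _ fun τ _ => (hGi τ).comp h.measurable_coupling).symm
      _ ≤ ((N ! : ℕ) : ℝ≥0∞)⁻¹ * ∫⁻ _ω, (N ! : ℕ) * r ∂P := by
          exact mul_le_mul_right (lintegral_mono_ae hle) _
      _ = r := by
          rw [lintegral_const, measure_univ, mul_one,
            ENNReal.inv_mul_cancel_left (by simp [Nat.factorial_ne_zero]) (by simp)]
  -- The external randomness is independent of everything else, so the success event is sliced at
  -- fixed `u`, where `hslice` applies.
  let W : Set (𝓤 × Equiv.Perm (Fin N) × (Fin K → Coupling N) × Data N K n) :=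
    {p | s (p.2.2.2, p.2.2.1, p.1) = supportUnion d p.2.1}
  have hW : MeasurableSet W := by
    have hun : W = ⋃ τ : Equiv.Perm (Fin N), {p | s (p.2.2.2, p.2.2.1, p.1) = supportUnion d τ} ∩
        {p | p.2.1 = τ} := by
      ext p; simp [W]
    rw [hun]
    refine MeasurableSet.iUnion fun τ => MeasurableSet.inter ?_ ?_
    · have : Measurable fun p : 𝓤 × Equiv.Perm (Fin N) × (Fin K → Coupling N) × Data N K n =>
        s (p.2.2.2, p.2.2.1, p.1) := hs.comp (by fun_prop)
      exact this (measurableSet_singleton _)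
    · exact (measurable_fst.comp measurable_snd) (MeasurableSpace.measurableSet_top (s := {τ}))
  have hpre : {ω | S' ω = supportUnion d (π ω)} = (fun ω => (U ω, (π ω, Q ω, X ω))) ⁻¹' W := by
    ext ω; simp [W, hS's]
  have := Measure.isProbabilityMeasure_map (μ := P) hS.measurable_rand.aemeasurable
  have := Measure.isProbabilityMeasure_map (μ := P) hY.aemeasurable
  rw [hpre, ← Measure.map_apply (hS.measurable_rand.prodMk hY) hW,
    hS.indep.map_prod_eq_prod_map_map hS.measurable_rand.aemeasurable hY.aemeasurable,
    Measure.prod_apply hW]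
  calc _ ≤ ∫⁻ _u, r ∂P.map U := by
        refine lintegral_mono fun u => ?_
        rw [Measure.map_apply hY (measurable_prodMk_left hW)]
        exact hslice u
    _ = r := by simp

open Classical in
/-- Fano's inequality for the experiment. -/
lemma IsEstimate.mul_success_le (h : IsExperiment d P π Q X) (hd2 : Even d) (hd0 : 0 < d)
    (hd : d + 2 ≤ N) (hS : IsEstimate P π Q X U S') {M : ℝ} (hM : 0 < M)
    (hcard : ∀ S : Set (Fin N × Fin N), ((Finset.univ.filter fun τ : Equiv.Perm (Fin N) =>
      supportUnion d τ = S).card : ℝ) * M ≤ N !) {t : ℝ} (ht : 0 < t) (L : ℝ) :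
    t * P.real {ω | S' ω = supportUnion d (π ω)} ≤
      (n * K : ℝ) * (N / (4 * d)) + (1 + (Real.exp t - 1) / M) / Real.exp L - 1 + L := by
  set b := (n * K : ℝ) * (N / (4 * d)) + (1 + (Real.exp t - 1) / M) / Real.exp L - 1 + L
  have hF : (0 : ℝ) < N ! := by exact_mod_cast Nat.factorial_pos N
  have hfix : ∀ q : Fin K → Coupling N, (∀ k, q k ∈ couplingBox N d) →
      ∀ s : Data N K n → Set (Fin N × Fin N), Measurable s →
        ∑ τ, (dataLaw n d τ q).real {x | s x = supportUnion d τ} ≤ N ! * (b / t) := by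
    intro q hq s hs
    have := mul_sum_dataLaw_le hd2 hd0 hd hM hcard hq hs ht.le L
    rw [← mul_div_assoc, le_div_iff₀ ht, mul_comm]
    exact this
  have hmain := hS.measure_success_le h hd2 hd0 hd (ENNReal.ofReal (b / t)) (by
    intro q hq s hs
    have := ENNReal.ofReal_le_ofReal (hfix q hq s hs)
    rw [ENNReal.ofReal_sum_of_nonneg fun _ _ => measureReal_nonneg, ENNReal.ofReal_mul hF.le,
      ENNReal.ofReal_natCast] at this
    refine le_trans (le_of_eq (Finset.sum_congr rfl fun τ _ => ?_)) this
    exact (ofReal_measureReal (measure_ne_top _ _)).symm)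
  -- Nonnegativity is needed to return from `ENNReal.ofReal`. It is read off the bound itself, at
  -- zero couplings and a constant estimate.
  have hb : 0 ≤ b / t := by
    have hbox : ∀ k, (fun _ => 0 : Fin K → Coupling N) k ∈ couplingBox N d := by
      intro k
      have : (0 : ℝ) ≤ 1 / (2 * (d : ℝ)) := by positivity
      exact ⟨fun _ _ => rfl, fun _ _ => ⟨neg_nonpos.2 this, this⟩⟩
    have := (Finset.sum_nonneg fun τ _ => measureReal_nonneg).trans
      (hfix _ hbox (fun _ => ∅) measurable_const)
    exact nonneg_of_mul_nonneg_right this hF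
  have := ENNReal.toReal_le_of_le_ofReal hb hmain
  rw [le_div_iff₀ ht] at this
  rw [mul_comm]
  exact this

end Transfer

/-! ### Numerical estimates. -/

lemma log_five_gt : 1.584 < Real.log 5 := by
  have h1 : Real.log ((2 : ℝ) ^ 16) ≤ Real.log ((5 : ℝ) ^ 7) :=
    Real.log_le_log (by norm_num) (by norm_num)
  rw [Real.log_pow, Real.log_pow] at h1
  push_cast at h1
  linarith [Real.log_two_gt_d9]

lemma log_count_pos {N : ℕ} (hN : 5 ≤ N) :
    0 < (N : ℝ) * Real.log N - N - Real.log (2 * N) := by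
  have hN' : (5 : ℝ) ≤ N := by exact_mod_cast hN
  have h1 : Real.log 5 ≤ Real.log N := Real.log_le_log (by norm_num) hN'
  rw [Real.log_mul two_ne_zero (by linarith)]
  nlinarith [log_five_gt, Real.log_two_lt_d9]

lemma log_count_le {N : ℕ} (hN : 0 < N) :
    (N : ℝ) * Real.log N - N - Real.log (2 * N) ≤ Real.log (N ! / (2 * N)) := by
  have hN' : (0 : ℝ) < N := by exact_mod_cast hN
  have hN1 : (1 : ℝ) ≤ N := by exact_mod_cast hN
  have hF : (0 : ℝ) < N ! := by exact_mod_cast Nat.factorial_pos N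
  rw [Real.log_div hF.ne' (by positivity)]
  have := Stirling.le_log_factorial_stirling hN.ne'
  have h1 : 0 ≤ Real.log N := Real.log_nonneg hN1
  have h2 : 0 ≤ Real.log (2 * Real.pi) := Real.log_nonneg (by linarith [Real.pi_gt_three])
  linarith

/-- For the case d + 2 = N without samples, where success is at most (e − 1)/h!. The value h = 3
uses 3⁵ ≤ 2⁸; for h ≥ 4, h! ≥ 2h(h − 1) is set against the tangent to the logarithm of h/4 at 1. -/
lemma exp_sub_one_mul_log_count_lt {h : ℕ} (hh : 3 ≤ h) :
    (Real.exp 1 - 1) * ((2 * h : ℝ) * Real.log (2 * h) - 2 * h - Real.log (2 * (2 * h))) <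
      Real.log 2 * h ! := by
  have he := Real.exp_one_lt_d9
  have he0 := Real.exp_one_gt_d9
  have hl := Real.log_two_gt_d9
  have hl' := Real.log_two_lt_d9
  obtain rfl | hh4 := hh.eq_or_lt
  · have h3 : Real.log ((3 : ℝ) ^ 5) ≤ Real.log ((2 : ℝ) ^ 8) :=
      Real.log_le_log (by norm_num) (by norm_num)
    rw [Real.log_pow, Real.log_pow] at h3
    have e6 : Real.log (2 * (3 : ℕ)) = Real.log 2 + Real.log 3 := by
      rw [Real.log_mul two_ne_zero (by norm_num)]; norm_num
    have e12 : Real.log (2 * (2 * (3 : ℕ))) = Real.log 2 + (Real.log 2 + Real.log 3) := by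
      rw [Real.log_mul two_ne_zero (by norm_num), e6]
    rw [e12, e6]
    simp only [Nat.factorial]
    push_cast at h3 ⊢
    have : 2 * 3 * (Real.log 2 + Real.log 3) - 2 * 3 - (Real.log 2 + (Real.log 2 + Real.log 3)) ≤
        2.318 := by linarith
    nlinarith
  · have hh' : (4 : ℝ) ≤ h := by exact_mod_cast hh4
    have hfac : (2 * h * (h - 1) : ℝ) ≤ h ! := by
      obtain ⟨m, rfl⟩ : ∃ m, h = m + 2 := ⟨h - 2, by omega⟩
      have : 2 ≤ m ! := by
        calc 2 = 2 ! := rfl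
          _ ≤ m ! := Nat.factorial_le (by omega)
      have : (2 : ℝ) ≤ m ! := by exact_mod_cast this
      rw [Nat.factorial_succ, Nat.factorial_succ]
      push_cast
      have hm : (0 : ℝ) ≤ m := Nat.cast_nonneg m
      nlinarith [mul_nonneg (mul_nonneg (by linarith : (0 : ℝ) ≤ m + 2) (by linarith : (0 : ℝ) ≤ m + 1))
        (by linarith : (0 : ℝ) ≤ (m ! : ℝ) - 2)]
    have hlog : Real.log (2 * h) ≤ 3 * Real.log 2 + (h / 4 - 1) := by
      have e : (2 * h : ℝ) = 2 ^ 3 * (h / 4) := by ring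
      rw [e, Real.log_mul (by norm_num) (by linarith), Real.log_pow]
      have := Real.log_le_sub_one_of_pos (by linarith : (0 : ℝ) < h / 4)
      push_cast
      linarith
    have hlog2 : 0 ≤ Real.log (2 * (2 * h)) := Real.log_nonneg (by linarith)
    have h1 : (2 * h : ℝ) * Real.log (2 * h) - 2 * h - Real.log (2 * (2 * h)) ≤
        2 * h * (h / 4 + 0.0796) := by
      nlinarith
    calc _ ≤ (Real.exp 1 - 1) * (2 * h * (h / 4 + 0.0796)) := by
          apply mul_le_mul_of_nonneg_left h1; linarith
      _ ≤ 1.7183 * (2 * h * (h / 4 + 0.0796)) := by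
          apply mul_le_mul_of_nonneg_right (by linarith); positivity
      _ = 2 * h * (1.7183 * (h / 4 + 0.0796)) := by ring
      _ < 2 * h * (0.693 * (h - 1) ) := by
          apply mul_lt_mul_of_pos_left _ (by linarith)
          linarith
      _ = 0.693 * (2 * h * (h - 1)) := by ring
      _ ≤ 0.693 * h ! := by linarith
      _ ≤ _ := by
          apply mul_le_mul_of_nonneg_right (by linarith)
          positivity

/-- From h! ≥ h(h − 1) ≥ (2h)²/6 for h ≥ 3. The factor 1.07 absorbs 3/8 + log 2 in the case d + 2 =
N with at least one sample. -/
lemma log_count_le_log_factorial_half {h : ℕ} (hh : 3 ≤ h) :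
    1.07 * (Real.log (2 * h) - 1) ≤ Real.log (h ! : ℝ) := by
  have hh' : (3 : ℝ) ≤ h := by exact_mod_cast hh
  have hfac : (2 * h : ℝ) ^ 2 / 6 ≤ h ! := by
    obtain ⟨m, rfl⟩ : ∃ m, h = m + 2 := ⟨h - 2, by omega⟩
    have : (1 : ℝ) ≤ m ! := by exact_mod_cast Nat.factorial_pos m
    rw [Nat.factorial_succ, Nat.factorial_succ]
    push_cast at hh' ⊢
    nlinarith [mul_nonneg (mul_nonneg (by linarith : (0 : ℝ) ≤ m + 2) (by linarith : (0 : ℝ) ≤ m + 1))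
        (by linarith : (0 : ℝ) ≤ (m ! : ℝ) - 1)]
  have h1 := Real.log_le_log (by positivity) hfac
  rw [Real.log_div (by positivity) (by norm_num), Real.log_pow] at h1
  have h6 : Real.log 6 ≤ Real.log (2 * h) := Real.log_le_log (by norm_num) (by linarith)
  have h6' : Real.log 6 ≤ 5 := by
    have := Real.log_le_sub_one_of_pos (by norm_num : (0 : ℝ) < 6)
    linarith
  push_cast at h1
  linarith

/-! ### The lower bounds on the failure probability. -/

section Bound

variable {Ω 𝓤 : Type*} [MeasurableSpace Ω] [MeasurableSpace 𝓤] {N K n d : ℕ} {P : Measure Ω}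
  [IsProbabilityMeasure P] {π : Ω → Equiv.Perm (Fin N)} {Q : Ω → Fin K → Coupling N}
  {X : Ω → Data N K n} {U : Ω → 𝓤} {S' : Ω → Set (Fin N × Fin N)}

open Classical in
lemma IsEstimate.log_mul_success_lt (h : IsExperiment d P π Q X) (hd2 : Even d) (hd0 : 0 < d)
    (hd : d + 2 ≤ N) (hS : IsEstimate P π Q X U S') {M : ℝ} (hM : 1 < M)
    (hcard : ∀ S : Set (Fin N × Fin N), ((Finset.univ.filter fun τ : Equiv.Perm (Fin N) =>
      supportUnion d τ = S).card : ℝ) * M ≤ N !) :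
    Real.log M * P.real {ω | S' ω = supportUnion d (π ω)} <
      (n * K : ℝ) * (N / (4 * d)) + Real.log 2 := by
  have hM0 : 0 < M := by linarith
  -- With t = log M the argument 1 + (M − 1)/M of the logarithm is just below 2; touching at e^L = 2
  -- costs log 2 and leaves a strict inequality.
  have := hS.mul_success_le h hd2 hd0 hd hM0 hcard (Real.log_pos hM) (Real.log 2)
  rw [Real.exp_log hM0, Real.exp_log two_pos] at this
  have h1 : (1 + (M - 1) / M) / 2 < 1 := by
    rw [sub_div, div_self hM0.ne']
    have : 0 < 1 / M := by positivity
    linarith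
  linarith

lemma IsEstimate.success_mul_lt_of_add_three_le (h : IsExperiment d P π Q X) (hN : 5 ≤ N)
    (hd2 : Even d) (hd0 : 0 < d) (hd : d + 3 ≤ N) (hS : IsEstimate P π Q X U S') :
    P.real {ω | S' ω = supportUnion d (π ω)} * (N * Real.log N - N - Real.log (2 * N)) <
      (n : ℝ) * N * K + Real.log 2 := by
  have hN' : (0 : ℝ) < N := by exact_mod_cast (by omega : 0 < N)
  have hd1 : (1 : ℝ) ≤ d := by exact_mod_cast hd0
  have hM : 1 < (N ! : ℝ) / (2 * N) := by
    rw [lt_div_iff₀ (by positivity), one_mul]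
    obtain ⟨m, rfl⟩ : ∃ m, N = m + 1 := ⟨N - 1, by omega⟩
    have : 3 ≤ m ! := by
      calc 3 ≤ 3 ! := by decide
        _ ≤ m ! := Nat.factorial_le (by omega)
    have : (3 : ℝ) ≤ m ! := by exact_mod_cast this
    rw [Nat.factorial_succ]
    push_cast at hN' ⊢
    nlinarith
  have hlt := hS.log_mul_success_lt h hd2 hd0 (by omega) hM fun S => by
    rw [← mul_div_assoc, div_le_iff₀ (by positivity), mul_comm]
    gcongr
    exact_mod_cast card_fibre_le hd2 hd0 hd S
  have hp : 0 ≤ P.real {ω | S' ω = supportUnion d (π ω)} := measureReal_nonneg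
  have hle := mul_le_mul_of_nonneg_left (log_count_le (by omega : 0 < N)) hp
  have hI : (n * K : ℝ) * (N / (4 * d)) ≤ (n * K : ℝ) * N := by
    apply mul_le_mul_of_nonneg_left _ (by positivity)
    exact div_le_self hN'.le (by linarith)
  linarith

lemma IsEstimate.success_mul_lt_of_add_two_eq (h : IsExperiment d P π Q X) (hN : 5 ≤ N)
    (hd2 : Even d) (hd0 : 0 < d) (hd : d + 2 = N) (hS : IsEstimate P π Q X U S') :
    P.real {ω | S' ω = supportUnion d (π ω)} * (N * Real.log N - N - Real.log (2 * N)) <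
      (n : ℝ) * N * K + Real.log 2 := by
  obtain ⟨m, hm⟩ : ∃ m, N = 2 * m := by
    obtain ⟨r, hr⟩ := hd2
    exact ⟨r + 1, by omega⟩
  subst hm
  obtain rfl : d = 2 * m - 2 := by omega
  have hm3 : 3 ≤ m := by omega
  have hm3' : (3 : ℝ) ≤ m := by exact_mod_cast hm3
  have hdcast : ((2 * m - 2 : ℕ) : ℝ) = 2 * m - 2 := by
    rw [Nat.cast_sub (by omega)]; push_cast; ring
  have hF : (6 : ℝ) ≤ m ! := by
    have : 6 ≤ m ! := by
      calc 6 = 3 ! := rfl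
        _ ≤ m ! := Nat.factorial_le hm3
    exact_mod_cast this
  have hcard : ∀ S : Set (Fin (2 * m) × Fin (2 * m)), ((Finset.univ.filter
      fun τ : Equiv.Perm (Fin (2 * m)) => supportUnion (2 * m - 2) τ = S).card : ℝ) * (m ! : ℝ) ≤
        (2 * m)! := fun S => by exact_mod_cast card_fibre_mul_le (by omega) S
  have hD := log_count_pos hN
  set p := P.real {ω | S' ω = supportUnion (2 * m - 2) (π ω)}
  have hp : 0 ≤ p := measureReal_nonneg
  have hl := Real.log_two_gt_d9
  have hl' := Real.log_two_lt_d9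
  by_cases hnK : n * K = 0
  -- No information: t = 1 and L = 0 give success at most (e − 1)/m!, sharper here than the choice t
  -- = log M.
  · have hnK' : (n * K : ℝ) = 0 := by exact_mod_cast hnK
    have h1 := hS.mul_success_le h hd2 hd0 hd.le (by linarith : (0 : ℝ) < m !) hcard one_pos 0
    rw [hnK', Real.exp_zero] at h1
    have h2 : p * m ! ≤ Real.exp 1 - 1 := by
      rw [← le_div_iff₀ (by linarith)]
      linarith
    have h3 := exp_sub_one_mul_log_count_lt hm3
    have h4 : (n : ℝ) * (2 * m : ℕ) * K = 0 := by
      rw [mul_right_comm, hnK', zero_mul]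
    rw [h4, zero_add]
    push_cast at hD ⊢
    have h5 := mul_le_mul_of_nonneg_right h2 hD.le
    have h6 : p * (2 * m * Real.log (2 * m) - 2 * m - Real.log (2 * (2 * m))) * m ! <
        Real.log 2 * m ! := by linarith
    exact lt_of_mul_lt_mul_right h6 (by linarith)
  -- Since nK ≥ 1, the constant log 2 is absorbed: 3/8·nK + log 2 ≤ 1.07·nK. Here 3/8 is the value
  -- of N/(4d) at m = 3, its maximum.
  · have hnK' : (1 : ℝ) ≤ n * K := by exact_mod_cast Nat.one_le_iff_ne_zero.2 hnK
    have h1 := hS.log_mul_success_lt h hd2 hd0 hd.le (by linarith : (1 : ℝ) < m !) hcard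
    have h2 : ((2 * m : ℕ) : ℝ) / (4 * (2 * m - 2 : ℕ)) ≤ 3 / 8 := by
      rw [hdcast, div_le_iff₀ (by linarith)]
      push_cast
      linarith
    have h3 : Real.log (m ! : ℝ) * p < 1.07 * (n * K : ℝ) := by
      have := mul_le_mul_of_nonneg_left h2 (by linarith : (0 : ℝ) ≤ n * K)
      linarith
    have h4 := mul_le_mul_of_nonneg_right (log_count_le_log_factorial_half hm3) hp
    have h5 : (Real.log (2 * m) - 1) * p ≤ n * K := by linarith
    have h6 : 0 ≤ Real.log (2 * (2 * m)) := Real.log_nonneg (by linarith)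
    have h7 := mul_le_mul_of_nonneg_left h5 (by linarith : (0 : ℝ) ≤ 2 * m)
    have h8 := mul_nonneg hp h6
    push_cast
    linarith

lemma IsEstimate.success_mul_lt (h : IsExperiment d P π Q X) (hN : 5 ≤ N)
    (hd2 : Even d) (hd0 : 0 < d) (hd : d + 2 ≤ N) (hS : IsEstimate P π Q X U S') :
    P.real {ω | S' ω = supportUnion d (π ω)} * (N * Real.log N - N - Real.log (2 * N)) <
      (n : ℝ) * N * K + Real.log 2 := by
  rcases hd.eq_or_lt with hd | hd
  · exact hS.success_mul_lt_of_add_two_eq h hN hd2 hd0 hd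
  · exact hS.success_mul_lt_of_add_three_le h hN hd2 hd0 hd

lemma IsEstimate.one_sub_lt_failure (h : IsExperiment d P π Q X) (hN : 5 ≤ N)
    (hd2 : Even d) (hd0 : 0 < d) (hd : d + 2 ≤ N) (hS : IsEstimate P π Q X U S') :
    1 - ((n : ℝ) * N * K + Real.log 2) / (N * Real.log N - N - Real.log (2 * N)) <
      P.real {ω | S' ω ≠ supportUnion d (π ω)} := by
  have h1 := hS.success_mul_lt h hN hd2 hd0 hd
  rw [← lt_div_iff₀ (log_count_pos hN)] at h1
  have h2 : 1 ≤ P.real {ω | S' ω = supportUnion d (π ω)} +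
      P.real {ω | S' ω ≠ supportUnion d (π ω)} := by
    have h3 := measureReal_union_le (μ := P) {ω | S' ω = supportUnion d (π ω)}
      {ω | S' ω ≠ supportUnion d (π ω)}
    have h4 : {ω | S' ω = supportUnion d (π ω)} ∪ {ω | S' ω ≠ supportUnion d (π ω)} =
        Set.univ := Set.union_compl_self _
    rwa [h4, probReal_univ] at h3
  linarith

lemma IsEstimate.half_lt_failure (h : IsExperiment d P π Q X) (hN : 5 ≤ N)
    (hd2 : Even d) (hd0 : 0 < d) (hd : d + 2 ≤ N) (hS : IsEstimate P π Q X U S') (hK : 0 < K)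
    (hn : (n : ℝ) ≤ Real.log N / (2 * K) - 1 / (2 * K) - Real.log (8 * N) / (2 * N * K)) :
    1 / 2 < P.real {ω | S' ω ≠ supportUnion d (π ω)} := by
  have hN' : (0 : ℝ) < N := by exact_mod_cast (by omega : 0 < N)
  have hK' : (0 : ℝ) < K := by exact_mod_cast hK
  have h1 := hS.one_sub_lt_failure h hN hd2 hd0 hd
  have hD := log_count_pos hN
  -- The extra 2 log 2 in log(8N) is twice the log 2 of the numerator, so the assumption on `n` says
  -- exactly that the ratio is at most 1/2. The strict conclusion comes from the strict Fano bound.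
  have e : Real.log (8 * N) = Real.log (2 * N) + 2 * Real.log 2 := by
    rw [show (8 * N : ℝ) = 2 * N * 2 ^ 2 by ring, Real.log_mul (by positivity) (by norm_num),
      Real.log_pow]
    norm_num
  have h2 : (n : ℝ) * (2 * N * K) ≤ N * Real.log N - N - Real.log (8 * N) := by
    calc _ ≤ (Real.log N / (2 * K) - 1 / (2 * K) - Real.log (8 * N) / (2 * N * K)) *
          (2 * N * K) := by gcongr
      _ = _ := by field_simp
  have h3 : ((n : ℝ) * N * K + Real.log 2) / (N * Real.log N - N - Real.log (2 * N)) ≤ 1 / 2 := by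
    rw [div_le_iff₀ hD]
    linarith
  linarith

lemma IsEstimate.log_div_le (h : IsExperiment d P π Q X) (hN : 16 ≤ N)
    (hd2 : Even d) (hd0 : 0 < d) (hd : d + 2 ≤ N) (hS : IsEstimate P π Q X U S') (hK : 0 < K)
    (hP : P.real {ω | S' ω ≠ supportUnion d (π ω)} ≤ 1 / 2) :
    1 / 8 * (Real.log N / K) ≤ n := by
  by_contra! hcon
  have hN' : (16 : ℝ) ≤ N := by exact_mod_cast hN
  have hK' : (0 : ℝ) < K := by exact_mod_cast hK
  refine hP.not_gt (hS.half_lt_failure h (by omega) hd2 hd0 hd hK (hcon.le.trans ?_))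
  have hl := Real.log_two_gt_d9
  have hl' := Real.log_two_lt_d9
  have h16 : 4 * Real.log 2 ≤ Real.log N := by
    have := Real.log_le_log (by norm_num) hN'
    rw [show (16 : ℝ) = 2 ^ 4 by norm_num, Real.log_pow] at this
    exact_mod_cast this
  have e : Real.log (8 * N) = 3 * Real.log 2 + Real.log N := by
    rw [Real.log_mul (by norm_num) (by linarith), show (8 : ℝ) = 2 ^ 3 by norm_num, Real.log_pow]
    norm_num
  -- For N ≥ 16 the correction log(8N)/N is a small fraction of log N, which leaves ample room for
  -- the constant 1/8.
  have h8 : Real.log (8 * N) / N ≤ (3 * Real.log 2 + Real.log N) / 16 := by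
    rw [e]
    exact div_le_div_of_nonneg_left (by linarith) (by norm_num) hN'
  have hsplit : Real.log N / (2 * K) - 1 / (2 * K) - Real.log (8 * N) / (2 * N * K) =
      (Real.log N - 1 - Real.log (8 * N) / N) / 2 / K := by
    field_simp
  rw [hsplit, ← mul_div_assoc]
  gcongr
  linarith

end Bound

end SupportUnion

theorem theorem3 :
    (∀ N d : ℕ, 5 ≤ N → Even d → 0 < d → d + 2 ≤ N →
      -- the random graph is `d`-regular, and the model is a multivariate sub-Gaussian one
      (∀ π : Equiv.Perm (Fin N),
        (∀ a, {b | (a, b) ∈ SupportUnion.edgeSet d π}.ncard = d) ∧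
        ∀ q ∈ SupportUnion.couplingBox N d,
          SupportUnion.matSupport (SupportUnion.precision d π q) ⊆
            SupportUnion.supportUnion d π ∧
          ∀ σ : ℝ≥0, 1 ≤ σ →
            SupportUnion.IsSubGaussianVector (SupportUnion.gaussianLaw d π q)
              (SupportUnion.precision d π q) σ) ∧
      ∀ (K n : ℕ) (Ω : Type*) [MeasurableSpace Ω] (P : Measure Ω) [IsProbabilityMeasure P]
        (π : Ω → Equiv.Perm (Fin N)) (Q : Ω → Fin K → SupportUnion.Coupling N)
        (X : Ω → SupportUnion.Data N K n), SupportUnion.IsExperiment d P π Q X →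
        -- for i.i.d. `Q^(k)` near a common matrix, conditionally on the permutation the samples
        -- follow a family of random sub-Gaussian distributions with support union `S`
        (∀ q₀ ∈ SupportUnion.couplingBox N d, (∀ a b, a ≠ b → q₀ a b ≠ 0) →
          iIndepFun (fun k ω => Q ω k) P →
          (∀ k l, IdentDistrib (fun ω => Q ω k) (fun ω => Q ω l) P P) →
          ∀ (τ : Equiv.Perm (Fin N)) (c : ℝ), 0 < c →
          (∀ r ∈ spectrum ℝ (SupportUnion.precision d τ q₀), c ≤ r / 2) →
          (∀ᵐ ω ∂P, ∀ k, ‖Matrix.toEuclideanCLM (𝕜 := ℝ)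
            (SupportUnion.edgeMatrix d τ ⊙ Matrix.of (Q ω k - q₀))‖ ≤ c) →
          ∀ σ : ℝ≥0, 1 ≤ σ →
            SupportUnion.IsRandomSubGaussianFamily (ProbabilityTheory.cond P {ω | π ω = τ})
              (SupportUnion.precision d τ q₀)
              (fun ω k a b =>
                (SupportUnion.edgeMatrix d τ ⊙ Matrix.of (Q ω k - q₀)) a b) X σ ∧
            SupportUnion.matSupport (SupportUnion.precision d τ q₀) =
              SupportUnion.supportUnion d τ) ∧
        -- the lower bound on the failure probability, for every estimate
        ∀ (𝓤 : Type*) [MeasurableSpace 𝓤] (U : Ω → 𝓤) (S' : Ω → Set (Fin N × Fin N)),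
          SupportUnion.IsEstimate P π Q X U S' →
          1 - ((n : ℝ) * N * K + Real.log 2) / (N * Real.log N - N - Real.log (2 * N)) ≤
            P.real {ω | S' ω ≠ SupportUnion.supportUnion d (π ω)} ∧
          (0 < K →
            (n : ℝ) ≤ Real.log N / (2 * K) - 1 / (2 * K) - Real.log (8 * N) / (2 * N * K) →
            1 / 2 < P.real {ω | S' ω ≠ SupportUnion.supportUnion d (π ω)})) ∧
    -- `Ω((log N) / K)` samples per task are necessary
    ∃ c : ℝ, 0 < c ∧ ∃ N₀ : ℕ, ∀ N d : ℕ, N₀ ≤ N → 5 ≤ N → Even d → 0 < d → d + 2 ≤ N →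
      ∀ (K n : ℕ), 0 < K → ∀ (Ω : Type*) [MeasurableSpace Ω] (P : Measure Ω)
        [IsProbabilityMeasure P] (π : Ω → Equiv.Perm (Fin N))
        (Q : Ω → Fin K → SupportUnion.Coupling N) (X : Ω → SupportUnion.Data N K n),
        SupportUnion.IsExperiment d P π Q X →
        ∀ (𝓤 : Type*) [MeasurableSpace 𝓤] (U : Ω → 𝓤) (S' : Ω → Set (Fin N × Fin N)),
          SupportUnion.IsEstimate P π Q X U S' →
          P.real {ω | S' ω ≠ SupportUnion.supportUnion d (π ω)} ≤ 1 / 2 →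
          c * (Real.log N / K) ≤ n := by
  refine ⟨fun N d hN hd2 hd0 hd => ⟨fun π => ⟨SupportUnion.ncard_neighbours hd2 hd π,
    fun q hq => ⟨SupportUnion.matSupport_precision_subset π q, fun σ hσ =>
      SupportUnion.isSubGaussianVector_multivariateGaussian
        (SupportUnion.precision_posDef hd2 hd0 hd π hq) hσ⟩⟩, ?_⟩,
    1 / 8, by norm_num, 16, ?_⟩
  · intro K n Ω _ P _ π Q X hexp
    refine ⟨fun q₀ hq₀ hne hindep hid τ c hc hspec hnorm σ hσ =>
      ⟨hexp.isRandomSubGaussianFamily hd2 hd0 hd hq₀ hne hindep hid τ hc hspec hnorm hσ,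
        SupportUnion.matSupport_precision_eq hd τ hne⟩, ?_⟩
    intro 𝓤 _ U S' hS
    exact ⟨(hS.one_sub_lt_failure hexp hN hd2 hd0 hd).le,
      hS.half_lt_failure hexp hN hd2 hd0 hd⟩
  · intro N d hN _ hd2 hd0 hd K n hK Ω _ P _ π Q X hexp 𝓤 _ U S' hS hP
    exact hS.log_div_le hexp hN hd2 hd0 hd hK hP
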